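/- Let $p$ be an odd prime, let $F$ be the field with $p$ elements, and let $G$ and $H$ be finite $p$-groups whose group algebras $FG$ and $FH$ are isomorphic as $F$-algebras. Write $\Phi(G)$ for the Frattini subgroup and $Z(G)$ for the center of $G$, put $\gamma_1(G)=G$ and $\gamma_{i+1}(G)=[\gamma_i(G),G]$ for $i\ge 1$, and let $\gamma_2(G)^p$ be the subgroup generated by the $p$-th powers of the elements of $\gamma_2(G)$ (and similarly for $H$). If $|G/\Phi(G)Z(G)|=p^2$, then $$G/\gamma_2(G)^p\gamma_4(G)\;\cong\; H/\gamma_2(H)^p\gamma_4(H).$$ -/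

import Mathlib

/-- The `i`-th term of the lower central series of `G`, counted from `1` as is usual in group
theory: `lowerCentral G 1 = G` and `lowerCentral G (i + 1) = [lowerCentral G i, G]` for `1 ≤ i`
(Mathlib counts from `0`). -/
def lowerCentral (G : Type*) [Group G] (i : ℕ) : Subgroup G :=
  (⊤ : Subgroup G).lowerCentralSeries (i - 1)

instance lowerCentral_normal (G : Type*) [Group G] (i : ℕ) : (lowerCentral G i).Normal := by
  unfold lowerCentral
  infer_instance

/-- The subgroup `N ^ n` generated by the `n`-th powers of the elements of `N`. -/
def powSubgroup {G : Type*} [Group G] (N : Subgroup G) (n : ℕ) : Subgroup G :=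
  Subgroup.closure {x : G | ∃ y ∈ N, y ^ n = x}

instance powSubgroup_normal {G : Type*} [Group G] (N : Subgroup G) [hN : N.Normal] (n : ℕ) :
    (powSubgroup N n).Normal := by
  refine ⟨fun x hx g => ?_⟩
  unfold powSubgroup at hx ⊢
  induction hx using Subgroup.closure_induction with
  | mem x h =>
    obtain ⟨y, hy, rfl⟩ := h
    exact Subgroup.subset_closure ⟨g * y * g⁻¹, hN.conj_mem y hy g, conj_pow⟩
  | one => simp
  | mul x y _ _ hx hy => simpa [mul_assoc] using mul_mem hx hy
  | inv x _ hx => simpa [mul_assoc] using inv_mem hx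

/-- The normal subgroup `γ₂(G)^p γ₄(G)`; the product of two normal subgroups is their join. -/
def gammaTwoPowGammaFour (p : ℕ) (G : Type*) [Group G] : Subgroup G :=
  powSubgroup (lowerCentral G 2) p ⊔ lowerCentral G 4

instance gammaTwoPowGammaFour_normal (p : ℕ) (G : Type*) [Group G] :
    (gammaTwoPowGammaFour p G).Normal := by
  unfold gammaTwoPowGammaFour
  infer_instance

-- Let `I` be the augmentation ideal of `FG`, `K` the kernel of `FG → F[G/G']`, and `A = FG/(KI +
-- IIK)`. Keep the letter `I` for its image in `A`, and let `M` be the image of `K`. Then `A/M` is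
-- commutative, `MI = 0` and `IIM = 0`. An isomorphism of group algebras respects augmentation and
-- commutator ideals, so `G` and `H` both map to `A`, by `i` and `j`. The kernels are exactly the
-- subgroups `γ₂^p γ₄` (`map_eq_one`, `mem_gammaTwoPowGammaFour_of_sub_one_mem`), and `G'` and `H'`
-- both have image `1 + M`. It remains to move `j(H)` into `i(G)` without changing it modulo `I²`.
--
-- The group `1 + I²` is abelian and normalises `i(G)`. A Frobenius argument in `F[G/G']` gives
-- factorisations `j k = i g * w` with `w ∈ 1 + I²` of controlled order, so a cyclic decomposition
-- of `H/H'` turns `w` into a homomorphism that is trivial on `H'` (`exists_factor_hom`). The map `k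
-- ↦ j k * (w k)⁻¹` has values in `i(G)`; its failure to be multiplicative is measured by the
-- biadditive bracket `β(x, y) = [w x, j y] ∈ IM`. If `β` is symmetric, adding `-β(x, x)/2` repairs
-- the map (`exists_hom_of_symmetric`); this needs `p` odd.
--
-- Symmetry is where the index `p²` enters. Let `H` be generated by `h₁`, `h₂` and `Φ(H)Z(H)`, put
-- `c = [j h₁, j h₂]` and `θ y = (j y - 1) * c`. Replacing `w` by `w - l • c` adds `l x • θ y` to
-- `β`. On `Φ(H)Z(H)` the map `θ` and the second argument of `β` vanish, while the first argument
-- gives multiples of `θ`. So the only remaining obstruction is `β(h₁, h₂) - β(h₂, h₁)`, which lies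
-- in `IM = ⟨θ h₁, θ h₂⟩` and is cancelled by a choice of `l h₁` and `l h₂`
-- (`exists_symmetrization`, `exists_hom`).
--
-- The hypothesis passes to `H` because `FG/(Z(FG) + I²)` is isomorphic to `G/Φ(G)Z(G)`
-- (`ker_toQuotient`). The construction gives surjections in both directions between finite groups,
-- hence an isomorphism.

universe u

/-- If every `x` is `S`-related to some `y` killed by the order of `x`, then the additive relation `S`
contains the graph of a homomorphism. -/
theorem AddSubgroup.exists_addMonoidHom_forall_mem {X Y : Type*} [AddCommGroup X] [Finite X]
    [AddCommGroup Y] (S : AddSubgroup (X × Y))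
    (hS : ∀ x, ∃ y, (x, y) ∈ S ∧ addOrderOf x • y = 0) :
    ∃ f : X →+ Y, ∀ x, (x, f x) ∈ S := by
  classical
  obtain ⟨ι, _, n, hn, ⟨e⟩⟩ := AddCommGroup.equiv_directSum_zmod_of_finite' X
  choose y hy hy0 using fun i => hS (e.symm (DirectSum.of (fun i => ZMod (n i)) i 1))
  have hord : ∀ i, addOrderOf (e.symm (DirectSum.of (fun i => ZMod (n i)) i 1)) ∣ n i := by
    intro i
    rw [addOrderOf_dvd_iff_nsmul_eq_zero, ← map_nsmul, ← map_nsmul]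
    simp
  -- The order condition, needed only at the cyclic generators, makes the map on each factor `ZMod
  -- (n i)` well defined.
  have hy1 : ∀ i, (n i) • y i = 0 := by
    intro i
    obtain ⟨k, hk⟩ := hord i
    rw [hk, mul_comm, mul_nsmul', hy0, nsmul_zero]
  let F : ∀ i, ZMod (n i) →+ Y := fun i =>
    ZMod.lift (n i) ⟨zmultiplesHom Y (y i), by simpa using hy1 i⟩
  have hF : ∀ d, (e.symm d, DirectSum.toAddMonoid F d) ∈ S := by
    intro d
    induction d using DirectSum.induction_on with
    | zero => rw [map_zero, map_zero]; exact S.zero_mem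
    | of i a =>
      obtain ⟨k, rfl⟩ := ZMod.intCast_surjective a
      have h1 : DirectSum.of (fun i => ZMod (n i)) i (k : ZMod (n i))
          = k • DirectSum.of (fun i => ZMod (n i)) i 1 := by
        rw [← map_zsmul]; simp
      have h2 : DirectSum.toAddMonoid F (DirectSum.of (fun i => ZMod (n i)) i (k : ZMod (n i)))
          = k • y i := by
        rw [DirectSum.toAddMonoid_of]
        simp [F]
      rw [h2, h1, map_zsmul]
      exact S.zsmul_mem (hy i) k
    | add a b ha hb =>
      rw [map_add, map_add]
      exact S.add_mem ha hb
  refine ⟨(DirectSum.toAddMonoid F).comp e.toAddMonoidHom, fun x => ?_⟩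
  simpa using hF (e x)

/-! ### Characters of order `p` and the Frattini subgroup of a `p`-group -/

section

variable {p : ℕ} [hp : Fact p.Prime] {G : Type*} [Group G]

/-- The abelian group structure on `G ⧸ N` when `N` contains the commutator subgroup. -/
abbrev quotientCommGroup (N : Subgroup G) [N.Normal] (hc : commutator G ≤ N) : CommGroup (G ⧸ N) :=
  { (inferInstance : Group (G ⧸ N)) with
    mul_comm := by
      intro a b
      induction a using QuotientGroup.induction_on with | H a =>
      induction b using QuotientGroup.induction_on with | H b =>
      rw [← QuotientGroup.mk_mul, ← QuotientGroup.mk_mul, QuotientGroup.eq]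
      apply hc
      rw [commutator_eq_closure]
      apply Subgroup.subset_closure
      exact ⟨b⁻¹, a⁻¹, by simp [commutatorElement_def, mul_assoc]⟩ }

/-- A normal subgroup with elementary abelian quotient is the kernel of an additive map to a
vector space. -/
theorem exists_module_hom {G : Type u} [Group G] (N : Subgroup G) [N.Normal] (hc : commutator G ≤ N)
    (hpow : ∀ x : G, x ^ p ∈ N) :
    ∃ (V : Type u) (_ : AddCommGroup V) (_ : Module (ZMod p) V) (d : G → V),
      (∀ x y, d (x * y) = d x + d y) ∧ (∀ x, d x = 0 ↔ x ∈ N) := by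
  let _ := quotientCommGroup N hc
  let _ : Module (ZMod p) (Additive (G ⧸ N)) := AddCommGroup.zmodModule (by
    intro x
    induction x using Additive.rec with | ofMul x =>
    induction x using QuotientGroup.induction_on with | H x =>
    rw [← ofMul_pow, ← QuotientGroup.mk_pow, (QuotientGroup.eq_one_iff _).2 (hpow x), ofMul_one])
  refine ⟨Additive (G ⧸ N), inferInstance, inferInstance, fun x => Additive.ofMul (x : G ⧸ N),
    fun x y => rfl, fun x => ?_⟩
  rw [ofMul_eq_zero, QuotientGroup.eq_one_iff]

/-- The quotient by `N` is a vector space over `ZMod p`, and linear functionals separate its points.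
-/
theorem exists_char_ne (N : Subgroup G) [N.Normal] (hc : commutator G ≤ N)
    (hpow : ∀ x : G, x ^ p ∈ N) {g : G} (hg : g ∉ N) :
    ∃ χ : G →* Multiplicative (ZMod p), N ≤ χ.ker ∧ χ g ≠ 1 := by
  obtain ⟨V, _, _, d, hd, hk⟩ := exists_module_hom N hc hpow
  have : d g ≠ 0 := fun h => hg ((hk g).1 h)
  have h2 : ∃ f : Module.Dual (ZMod p) V, f (d g) ≠ 0 := by
    by_contra! h
    exact this ((Module.forall_dual_apply_eq_zero_iff (ZMod p) _).1 h)
  obtain ⟨f, hf⟩ := h2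
  refine ⟨MonoidHom.mk' (fun x => Multiplicative.ofAdd (f (d x))) ?_, ?_, ?_⟩
  · intro x y
    rw [hd, map_add, ofAdd_add]
  · intro x hx
    rw [MonoidHom.mem_ker]
    rw [MonoidHom.mk'_apply, (hk x).2 hx, map_zero, ofAdd_zero]
  · simpa using hf

theorem index_of_isCoatom [Finite G] (hG : IsPGroup p G) {M : Subgroup G} (hM : IsCoatom M) :
    ∃ _ : M.Normal, Nat.card (G ⧸ M) = p := by
  have hnil : Group.IsNilpotent G := hG.isNilpotent
  have hN : M.Normal := Subgroup.NormalizerCondition.normal_of_coatom M Group.normalizerCondition_of_isNilpotent hM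
  refine ⟨hN, ?_⟩
  have hQ : IsPGroup p (G ⧸ M) := hG.to_quotient M
  have hnt : Nat.card (G ⧸ M) ≠ 1 := by
    intro h
    exact hM.1 (Subgroup.index_eq_one.1 h)
  have hdvd : p ∣ Nat.card (G ⧸ M) := (hQ.card_eq_or_dvd).resolve_left hnt
  obtain ⟨x, hx⟩ := exists_prime_orderOf_dvd_card' p hdvd
  have htop : Subgroup.zpowers x = ⊤ := by
    have hle : M ≤ (Subgroup.zpowers x).comap (QuotientGroup.mk' M) := by
      intro m hm
      rw [Subgroup.mem_comap, QuotientGroup.mk'_apply, (QuotientGroup.eq_one_iff m).2 hm]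
      exact one_mem _
    obtain ⟨y, rfl⟩ := QuotientGroup.mk_surjective x
    have hlt : M < (Subgroup.zpowers (y : G ⧸ M)).comap (QuotientGroup.mk' M) := by
      refine lt_of_le_of_ne hle fun h => ?_
      have : y ∈ M := by
        rw [h, Subgroup.mem_comap]
        exact Subgroup.mem_zpowers _
      rw [(QuotientGroup.eq_one_iff y).2 this, orderOf_one] at hx
      exact hp.out.one_lt.ne hx
    have := hM.2 _ hlt
    rw [eq_top_iff]
    intro z _
    obtain ⟨z, rfl⟩ := QuotientGroup.mk_surjective z
    have hz : z ∈ (Subgroup.zpowers (y : G ⧸ M)).comap (QuotientGroup.mk' M) := by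
      rw [this]; trivial
    exact hz
  rw [← hx, ← Nat.card_zpowers, htop, Subgroup.card_top]

theorem IsCoatom.commutator_le [Finite G] (hG : IsPGroup p G) {M : Subgroup G} (hM : IsCoatom M) :
    commutator G ≤ M := by
  obtain ⟨hN, hc⟩ := index_of_isCoatom hG hM
  have := isCyclic_of_prime_card hc
  let _ := IsCyclic.commGroup (α := G ⧸ M)
  rw [commutator_eq_closure, Subgroup.closure_le]
  rintro _ ⟨a, b, rfl⟩
  rw [SetLike.mem_coe, ← QuotientGroup.eq_one_iff, commutatorElement_def]
  simp only [QuotientGroup.mk_mul, QuotientGroup.mk_inv]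
  rw [mul_comm (a : G ⧸ M)]
  simp

theorem IsCoatom.pow_mem [Finite G] (hG : IsPGroup p G) {M : Subgroup G} (hM : IsCoatom M)
    (x : G) : x ^ p ∈ M := by
  obtain ⟨hN, hc⟩ := index_of_isCoatom hG hM
  rw [← QuotientGroup.eq_one_iff, QuotientGroup.mk_pow, ← hc, pow_card_eq_one']

theorem exists_char_of_ne_top [Finite G] (hG : IsPGroup p G) {S : Subgroup G} (hS : S ≠ ⊤) :
    ∃ χ : G →* Multiplicative (ZMod p), S ≤ χ.ker ∧ ∃ g, χ g ≠ 1 := by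
  obtain ⟨M, hM, hSM⟩ := (eq_top_or_exists_le_coatom S).resolve_left hS
  obtain ⟨hN, -⟩ := index_of_isCoatom hG hM
  obtain ⟨g, hg⟩ : ∃ g, g ∉ M := by
    by_contra! h
    exact hM.1 (eq_top_iff.2 fun x _ => h x)
  obtain ⟨χ, h1, h2⟩ := exists_char_ne M (hM.commutator_le hG) (hM.pow_mem hG) hg
  exact ⟨χ, hSM.trans h1, g, h2⟩

theorem commutator_le_frattini [Finite G] (hG : IsPGroup p G) : commutator G ≤ frattini G :=
  le_iInf₂ fun _ hM => IsCoatom.commutator_le hG hM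

theorem pow_mem_frattini [Finite G] (hG : IsPGroup p G) (x : G) : x ^ p ∈ frattini G := by
  simp only [frattini, Order.radical, Subgroup.mem_iInf]
  exact fun M hM => IsCoatom.pow_mem hG hM x

theorem isCoatom_ker (χ : G →* Multiplicative (ZMod p)) {g : G} (hg : χ g ≠ 1) :
    IsCoatom χ.ker := by
  have hsimple : ∀ K : Subgroup (Multiplicative (ZMod p)), K = ⊥ ∨ K = ⊤ := by
    intro K
    have : Fact (Nat.card (Multiplicative (ZMod p))).Prime := ⟨by simpa using hp.out⟩
    exact Subgroup.eq_bot_or_eq_top_of_prime_card K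
  refine ⟨fun h => hg (by rw [← MonoidHom.mem_ker, h]; trivial), fun K hK => ?_⟩
  have h1 : K.map χ = ⊤ := by
    refine (hsimple _).resolve_left fun h => hK.not_ge ?_
    intro x hx
    rw [MonoidHom.mem_ker, ← Subgroup.mem_bot, ← h]
    exact Subgroup.mem_map_of_mem _ hx
  rw [eq_top_iff]
  intro x _
  obtain ⟨k, hk, hkx⟩ : χ x ∈ K.map χ := by rw [h1]; trivial
  have : k⁻¹ * x ∈ χ.ker := by
    rw [MonoidHom.mem_ker, map_mul, map_inv, hkx]; simp
  simpa using K.mul_mem hk (hK.le this)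

/-- Modulo `G^p G'` the group is elementary abelian, so an element outside `G^p G'` is detected by a
character, whose kernel is a maximal subgroup. -/
theorem frattini_le_powSubgroup_sup_commutator [Finite G] :
    frattini G ≤ powSubgroup (⊤ : Subgroup G) p ⊔ commutator G := by
  intro g hg
  by_contra h
  obtain ⟨χ, h1, h2⟩ := exists_char_ne (p := p) _ le_sup_right
    (fun x => (le_sup_left : _ ≤ powSubgroup (⊤ : Subgroup G) p ⊔ commutator G)
      (Subgroup.subset_closure ⟨x, trivial, rfl⟩)) h
  exact h2 (frattini_le_coatom (isCoatom_ker χ h2) hg)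

end

/-! ### Arithmetic in an algebra with `M * I = 0` and `I * I * M = 0` -/

open scoped commutatorElement

theorem map_commutatorElement_sub_one {G A : Type*} [Group G] [Ring A] (i : G →* A) (a b : G) :
    i ⁅a, b⁆ - 1 = (i a * i b - i b * i a) * i (a⁻¹ * b⁻¹) := by
  have : b * a * (a⁻¹ * b⁻¹) = 1 := by group
  rw [sub_mul, ← map_mul, ← map_mul, ← map_mul, ← map_mul, this, map_one, commutatorElement_def]
  simp only [mul_assoc]

/-- A ring `A` with two-sided ideals `M ≤ I * I` such that `A ⧸ M` is commutative, `M * I = 0` and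
`I * I * M = 0`. -/
structure IsSmallAlgebra {p : ℕ} {A : Type*} [Ring A] [Algebra (ZMod p) A]
    (I M : Submodule (ZMod p) A) : Prop where
  mul_mem_left : ∀ a, ∀ x ∈ I, a * x ∈ I
  mul_mem_right : ∀ a, ∀ x ∈ I, x * a ∈ I
  mul_mem_left' : ∀ a, ∀ m ∈ M, a * m ∈ M
  comm : ∀ a b : A, a * b - b * a ∈ M
  le_sq : M ≤ I * I
  mul_eq_zero : ∀ m ∈ M, ∀ x ∈ I, m * x = 0
  mul_mul_eq_zero : ∀ x ∈ I, ∀ y ∈ I, ∀ m ∈ M, x * (y * m) = 0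
  exists_sub_mem : ∀ a : A, ∃ s : ZMod p, a - s • (1 : A) ∈ I

/-- A group homomorphism to `A` behaving like the inclusion of a group basis. -/
structure IsBasisHom {p : ℕ} {A : Type*} [Ring A] [Algebra (ZMod p) A]
    (I M : Submodule (ZMod p) A) {G : Type*} [Group G] (i : G →* A) : Prop where
  sub_one_mem : ∀ g, i g - 1 ∈ I
  exists_sub_mem_sq : ∀ x ∈ I, ∃ g, x - (i g - 1) ∈ I * I
  exists_commutator : ∀ m ∈ M, ∃ x ∈ commutator G, i x = 1 + m

namespace IsSmallAlgebra

variable {p : ℕ} {A : Type*} [Ring A] [Algebra (ZMod p) A] {I M : Submodule (ZMod p) A}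
  (h : IsSmallAlgebra I M)

include h

theorem sq_le : I * I ≤ I := Submodule.mul_le.2 fun x _ y hy => h.mul_mem_left x y hy

theorem le : M ≤ I := h.le_sq.trans h.sq_le

theorem sq_mul_mem_left (a : A) {u : A} (hu : u ∈ I * I) : a * u ∈ I * I := by
  induction hu using Submodule.mul_induction_on' with
  | mem_mul_mem x hx y hy =>
    rw [← mul_assoc]; exact Submodule.mul_mem_mul (h.mul_mem_left a x hx) hy
  | add x _ y _ hx hy => rw [mul_add]; exact add_mem hx hy

theorem sq_mul_eq_zero {u m : A} (hu : u ∈ I * I) (hm : m ∈ M) : u * m = 0 := by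
  induction hu using Submodule.mul_induction_on' with
  | mem_mul_mem x hx y hy => rw [mul_assoc]; exact h.mul_mul_eq_zero x hx y hy m hm
  | add x _ y _ hx hy => rw [add_mul, hx, hy, add_zero]

theorem mul_mem_right' (a : A) {m : A} (hm : m ∈ M) : m * a ∈ M := by
  have := add_mem (h.comm m a) (h.mul_mem_left' a m hm)
  simpa using this

theorem mul_eq_self {m u : A} (hm : m ∈ M) (hu : u - 1 ∈ I) : m * u = m := by
  have := h.mul_eq_zero m hm _ hu
  rw [mul_sub, mul_one, sub_eq_zero] at this
  exact this

theorem sq_mul_eq_self {m u : A} (hm : m ∈ M) (hu : u - 1 ∈ I * I) : u * m = m := by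
  have := h.sq_mul_eq_zero hu hm
  rwa [sub_mul, one_mul, sub_eq_zero] at this

theorem mem_of_mem_mul {t : A} (ht : t ∈ I * M) : t ∈ M :=
  Submodule.mul_le.2 (fun x _ m hm => h.mul_mem_left' x m hm) ht

theorem mul_le_sq : I * M ≤ I * I := mul_le_mul' le_rfl h.le

theorem mul_mul_mem_left (a : A) {t : A} (ht : t ∈ I * M) : a * t ∈ I * M := by
  induction ht using Submodule.mul_induction_on' with
  | mem_mul_mem x hx y hy =>
    rw [← mul_assoc]; exact Submodule.mul_mem_mul (h.mul_mem_left a x hx) hy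
  | add x _ y _ hx hy => rw [mul_add]; exact add_mem hx hy

theorem mul_eq_zero_of_mem_mul {x t : A} (hx : x ∈ I) (ht : t ∈ I * M) : x * t = 0 := by
  induction ht using Submodule.mul_induction_on' with
  | mem_mul_mem y hy m hm => exact h.mul_mul_eq_zero x hx y hy m hm
  | add y _ z _ hy hz => rw [mul_add, hy, hz, add_zero]

theorem mul_eq_self_of_mem_mul {u t : A} (hu : u - 1 ∈ I) (ht : t ∈ I * M) : u * t = t := by
  have := h.mul_eq_zero_of_mem_mul hu ht
  rwa [sub_mul, one_mul, sub_eq_zero] at this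

/-- Commutators lie in `M`, so `M * I = 0` lets two neighbours commute when an element of `I`
follows them. In `swap_left`, `I * I * M = 0` does the same after two elements of `I`. -/
theorem swap_right {x y z : A} (hz : z ∈ I) : x * y * z = y * x * z := by
  have := h.mul_eq_zero _ (h.comm x y) z hz
  rwa [sub_mul, sub_eq_zero] at this

theorem swap_left {x y z w : A} (hx : x ∈ I) (hy : y ∈ I) : x * y * (z * w) = x * y * (w * z) := by
  have := h.sq_mul_eq_zero (Submodule.mul_mem_mul hx hy) (h.comm z w)
  rwa [mul_sub, sub_eq_zero] at this

/-- In a product of four elements of `I` the first three positions may be permuted by `swap_right`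
and the last two by `swap_left`. -/
theorem sq_comm {u v : A} (hu : u ∈ I * I) (hv : v ∈ I * I) : u * v = v * u := by
  induction hu using Submodule.mul_induction_on' with
  | mem_mul_mem x hx y hy =>
    induction hv using Submodule.mul_induction_on' with
    | mem_mul_mem z hz t ht =>
      calc x * y * (z * t) = x * (y * z * t) := by noncomm_ring
        _ = x * (z * y * t) := by rw [h.swap_right ht]
        _ = x * z * (y * t) := by noncomm_ring
        _ = x * z * (t * y) := h.swap_left hx hz
        _ = (x * z * t) * y := by noncomm_ring
        _ = (z * x * t) * y := by rw [h.swap_right ht]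
        _ = z * (x * t * y) := by noncomm_ring
        _ = z * (t * x * y) := by rw [h.swap_right hy]
        _ = z * t * (x * y) := by noncomm_ring
    | add a _ b _ ha hb => rw [mul_add, ha, hb, add_mul]
  | add a _ b _ ha hb => rw [add_mul, ha, hb, mul_add]

/-- Commutators with elements of `I * I` lie in `I * M`. -/
theorem bracket_mem {u : A} (hu : u - 1 ∈ I * I) (a : A) : u * a - a * u ∈ I * M := by
  have key : ∀ v ∈ I * I, v * a - a * v ∈ I * M := by
    intro v hv
    induction hv using Submodule.mul_induction_on' with
    | mem_mul_mem x hx y hy =>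
      have : x * y * a - a * (x * y) = x * (y * a - a * y) + (x * a - a * x) * y := by noncomm_ring
      rw [this, h.mul_eq_zero _ (h.comm x a) y hy, add_zero]
      exact Submodule.mul_mem_mul hx (h.comm y a)
    | add x _ y _ hx hy =>
      have : (x + y) * a - a * (x + y) = (x * a - a * x) + (y * a - a * y) := by noncomm_ring
      rw [this]; exact add_mem hx hy
  have := key _ hu
  have e : u * a - a * u = (u - 1) * a - a * (u - 1) := by noncomm_ring
  rwa [e]

theorem one_comm {u v : A} (hu : u - 1 ∈ I * I) (hv : v - 1 ∈ I * I) : u * v = v * u := by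
  have := h.sq_comm hu hv
  have e : u * v - v * u = (u - 1) * (v - 1) - (v - 1) * (u - 1) := by noncomm_ring
  rw [← sub_eq_zero, e, this, sub_self]

/-- The bracket has values in `I * M`, on which `1 + I` acts trivially from both sides, so the
Leibniz rule becomes additivity. The same holds in the other argument. -/
theorem bracket_mul_left {u v : A} (hu : u - 1 ∈ I * I) (hv : v - 1 ∈ I * I) (a : A) :
    u * v * a - a * (u * v) = (u * a - a * u) + (v * a - a * v) := by
  have e : u * v * a - a * (u * v) = u * (v * a - a * v) + (u * a - a * u) * v := by noncomm_ring
  rw [e, h.mul_eq_self_of_mem_mul (h.sq_le hu) (h.bracket_mem hv a),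
    h.mul_eq_self (h.comm u a) (h.sq_le hv), add_comm]

theorem bracket_mul_right {u a b : A} (hu : u - 1 ∈ I * I) (ha : a - 1 ∈ I) (hb : b - 1 ∈ I) :
    u * (a * b) - a * b * u = (u * a - a * u) + (u * b - b * u) := by
  have e : u * (a * b) - a * b * u = a * (u * b - b * u) + (u * a - a * u) * b := by noncomm_ring
  rw [e, h.mul_eq_self_of_mem_mul ha (h.bracket_mem hu b), h.mul_eq_self (h.comm u a) hb, add_comm]

theorem mul_sub_one_mem {a b : A} (ha : a - 1 ∈ I) (hb : b - 1 ∈ I) : a * b - 1 ∈ I := by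
  have : a * b - 1 = a * (b - 1) + (a - 1) := by noncomm_ring
  rw [this]; exact add_mem (h.mul_mem_left _ _ hb) ha

theorem mul_sub_one_mem_sq {a b : A} (ha : a - 1 ∈ I * I) (hb : b - 1 ∈ I * I) :
    a * b - 1 ∈ I * I := by
  have : a * b - 1 = a * (b - 1) + (a - 1) := by noncomm_ring
  rw [this]; exact add_mem (h.sq_mul_mem_left _ hb) ha

/-- The factors need not commute: an element of `I` at the right end allows everything before it to
be rearranged. -/
theorem mul_pow_eq {a b : A} (hb : b ∈ I) (n : ℕ) : (a * b) ^ n = a ^ n * b ^ n := by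
  induction n with
  | zero => simp
  | succ n ih =>
    rw [pow_succ, ih]
    calc a ^ n * b ^ n * (a * b) = a ^ n * (b ^ n * a * b) := by noncomm_ring
      _ = a ^ n * (a * b ^ n * b) := by rw [h.swap_right hb]
      _ = a ^ (n + 1) * b ^ (n + 1) := by rw [pow_succ, pow_succ]; noncomm_ring

end IsSmallAlgebra

namespace IsSmallAlgebra

variable {p : ℕ} {A : Type*} [Ring A] [Algebra (ZMod p) A]
  {I M : Submodule (ZMod p) A} (h : IsSmallAlgebra I M) {G H : Type*} [Group G] [Group H]
  {i : G →* A} (hi : IsBasisHom I M i) {j : H →* A} (hj : IsBasisHom I M j)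

include h in
theorem commutator_sub_one_mem (i : G →* A) {x : G} (hx : x ∈ commutator G) : i x - 1 ∈ M := by
  rw [commutator_eq_closure] at hx
  induction hx using Subgroup.closure_induction with
  | mem x hx =>
    obtain ⟨a, b, rfl⟩ := hx
    rw [map_commutatorElement_sub_one]
    exact h.mul_mem_right' _ (h.comm _ _)
  | one => simp
  | mul x y _ _ hx hy =>
    have : i (x * y) - 1 = i x * (i y - 1) + (i x - 1) := by rw [map_mul]; noncomm_ring
    rw [this]; exact add_mem (h.mul_mem_left' _ _ hy) hx
  | inv x _ hx =>
    have : i x⁻¹ - 1 = -(i x⁻¹ * (i x - 1)) := by rw [mul_sub, ← map_mul]; simp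
    rw [this]; exact neg_mem (h.mul_mem_left' _ _ hx)

include h in
-- In `[x ^ (n + 1), a] = x ^ n * [x, a] + [x ^ n, a] * x` the last term is in `M * I = 0`. For `n =
-- p - 1 ≥ 2` the other is killed by `I * I * M = 0`; hence `3 ≤ p`.
theorem pow_char_comm (hp3 : 3 ≤ p) [CharP A p] [Fact p.Prime] {x : A} (hx : x ∈ I) (a : A) :
    x ^ p * a = a * x ^ p := by
  have key : ∀ n, x ^ (n + 1) * a - a * x ^ (n + 1) =
      x ^ n * (x * a - a * x) + (x ^ n * a - a * x ^ n) * x := by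
    intro n; rw [pow_succ]; noncomm_ring
  have h2 : ∀ n, x ^ (n + 1) * a - a * x ^ (n + 1) = x ^ n * (x * a - a * x) := by
    intro n
    rw [key, h.mul_eq_zero _ (h.comm _ _) x hx, add_zero]
  obtain ⟨k, rfl⟩ : ∃ k, p = k + 2 + 1 := ⟨p - 3, by omega⟩
  rw [← sub_eq_zero, h2, pow_add, mul_assoc, pow_two, mul_assoc,
    h.mul_mul_eq_zero x hx x hx _ (h.comm x a), mul_zero]

include h hi in
/-- `1 + I * I` normalises the image of a group basis. -/
theorem exists_swap {u : A} (hu : u - 1 ∈ I * I) (g : G) : ∃ g', u * i g = i g' * u := by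
  obtain ⟨x, -, hx⟩ := hi.exists_commutator _ (h.mem_of_mem_mul (h.bracket_mem hu (i g)))
  refine ⟨x * g, ?_⟩
  have hB := h.bracket_mem hu (i g)
  have hB' := h.mem_of_mem_mul hB
  rw [map_mul, hx, add_mul, add_mul, one_mul, mul_assoc, h.mul_eq_self hB'
    (h.mul_sub_one_mem (hi.sub_one_mem g) (h.sq_le hu))]
  abel

/-- The group of units congruent to `1` modulo `I * I`. -/
def unitsOneAddSq : Subgroup Aˣ where
  carrier := {u | (u : A) - 1 ∈ I * I}
  mul_mem' := fun ha hb => by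
    simpa using h.mul_sub_one_mem_sq ha hb
  one_mem' := by simp
  inv_mem' := fun {u} hu => by
    have : ((u⁻¹ : Aˣ) : A) - 1 = -(((u⁻¹ : Aˣ) : A) * ((u : A) - 1)) := by
      rw [mul_sub, Units.inv_mul]; simp
    rw [Set.mem_ofPred_eq, this]
    exact neg_mem (h.sq_mul_mem_left _ hu)

/-- `1 + I * I` is an abelian group. -/
abbrev unitsOneAddSqCommGroup : CommGroup h.unitsOneAddSq :=
  { (inferInstance : Group h.unitsOneAddSq) with
    mul_comm := fun a b => Subtype.ext (Units.ext (h.one_comm a.2 b.2)) }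

end IsSmallAlgebra

/-! ### Factoring one group basis over another through `1 + I * I` -/

/-- The elements whose `n`-th power lies in the commutator subgroup. -/
def rootsOfCommutator (G : Type*) [Group G] (n : ℕ) : Subgroup G :=
  ((powMonoidHom n).comp (Abelianization.of (G := G))).ker

theorem mem_rootsOfCommutator {G : Type*} [Group G] {n : ℕ} {x : G} :
    x ∈ rootsOfCommutator G n ↔ x ^ n ∈ commutator G := by
  rw [rootsOfCommutator, MonoidHom.mem_ker, MonoidHom.comp_apply, powMonoidHom_apply, ← map_pow,
    ← MonoidHom.mem_ker, Abelianization.ker_of]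

instance rootsOfCommutator_normal (G : Type*) [Group G] (n : ℕ) : (rootsOfCommutator G n).Normal :=
  MonoidHom.normal_ker _

namespace IsSmallAlgebra

variable {p : ℕ} {A : Type*} [Ring A] [Algebra (ZMod p) A]
  {I M : Submodule (ZMod p) A} (h : IsSmallAlgebra I M) {G H : Type*} [Group G] [Group H]
  {i : G →* A} (hi : IsBasisHom I M i) {j : H →* A} (hj : IsBasisHom I M j)

/-- The span of the products `(q - 1) * x` with `q ^ n` in the commutator subgroup and `x ∈ I`. -/
def rootSpan (I : Submodule (ZMod p) A) (i : G →* A) (n : ℕ) : Submodule (ZMod p) A :=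
  Submodule.span (ZMod p) {y | ∃ q ∈ rootsOfCommutator G n, ∃ x ∈ I, (i q - 1) * x = y}

include hi in
theorem rootSpan_le (n : ℕ) : rootSpan I i n ≤ I * I := by
  refine Submodule.span_le.2 ?_
  rintro _ ⟨q, -, x, hx, rfl⟩
  exact Submodule.mul_mem_mul (hi.sub_one_mem q) hx

include h in
theorem rootSpan_conj (n : ℕ) (g : G) {y : A} (hy : y ∈ rootSpan I i n) :
    i g * y ∈ rootSpan I i n := by
  induction hy using Submodule.span_induction with
  | mem y hy =>
    obtain ⟨q, hq, x, hx, rfl⟩ := hy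
    refine Submodule.subset_span ⟨g * q * g⁻¹, (rootsOfCommutator_normal G n).conj_mem q hq g,
      i g * x, h.mul_mem_left _ _ hx, ?_⟩
    rw [sub_mul, ← mul_assoc, ← map_mul]
    simp [mul_assoc, mul_sub, sub_mul]
  | zero => simp
  | add x y _ _ hx hy => rw [mul_add]; exact add_mem hx hy
  | smul a x _ hx => rw [mul_smul_comm]; exact Submodule.smul_mem _ _ hx

include h hi in
-- On the commuting elements of `I * I` the `p ^ e`-th power is additive, and it sends `(i q - 1) *
-- x` to `(i (q ^ p ^ e) - 1) * x ^ p ^ e`, which lies in `M * I = 0`.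
theorem pow_eq_zero_of_mem_rootSpan [Fact p.Prime] [CharP A p] (e : ℕ) {y : A}
    (hy : y ∈ rootSpan I i (p ^ e)) : y ^ p ^ e = 0 := by
  have hp : 0 < p ^ e := pow_pos (Fact.out : p.Prime).pos e
  induction hy using Submodule.span_induction with
  | mem y hy =>
    obtain ⟨q, hq, x, hx, rfl⟩ := hy
    rw [h.mul_pow_eq hx, sub_pow_char_pow_of_commute _ _ (Commute.one_right _), one_pow, ← map_pow]
    refine h.mul_eq_zero _ (h.commutator_sub_one_mem i (mem_rootsOfCommutator.1 hq)) _ ?_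
    obtain ⟨k, hk⟩ := Nat.exists_eq_succ_of_ne_zero hp.ne'
    rw [hk, pow_succ]
    exact h.mul_mem_left _ _ hx
  | zero => exact zero_pow hp.ne'
  | add x y hx hy hx' hy' =>
    rw [add_pow_char_pow_of_commute _ _ (h.sq_comm (rootSpan_le hi _ hx) (rootSpan_le hi _ hy)),
      hx', hy', add_zero]
  | smul a x _ hx => rw [smul_pow, hx, smul_zero]

include h hi in
-- Modulo `rootSpan` a factor `b` may be replaced by its scalar part, and `g ↦ i g - 1` turns
-- products of roots into sums. Hence every combination is congruent to a single group element minus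
-- one.
theorem exists_sub_mem_rootSpan [Fact p.Prime] (n : ℕ) {X : A}
    (hX : X ∈ Submodule.span (ZMod p) {y | ∃ q ∈ rootsOfCommutator G n, ∃ b : A,
      (i q - 1) * b = y}) : ∃ g ∈ rootsOfCommutator G n, X - (i g - 1) ∈ rootSpan I i n := by
  have hadd : ∀ X Y : A, (∃ g ∈ rootsOfCommutator G n, X - (i g - 1) ∈ rootSpan I i n) →
      (∃ g ∈ rootsOfCommutator G n, Y - (i g - 1) ∈ rootSpan I i n) →
      (∃ g ∈ rootsOfCommutator G n, X + Y - (i g - 1) ∈ rootSpan I i n) := by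
    rintro X Y ⟨g, hg, hX⟩ ⟨k, hk, hY⟩
    refine ⟨g * k, mul_mem hg hk, ?_⟩
    have e : X + Y - (i (g * k) - 1) =
        (X - (i g - 1)) + (Y - (i k - 1)) - (i g - 1) * (i k - 1) := by
      rw [map_mul]; noncomm_ring
    rw [e]
    exact sub_mem (add_mem hX hY) (Submodule.subset_span ⟨g, hg, _, hi.sub_one_mem k, rfl⟩)
  have hsmul : ∀ (s : ZMod p) (X : A),
      (∃ g ∈ rootsOfCommutator G n, X - (i g - 1) ∈ rootSpan I i n) →
      (∃ g ∈ rootsOfCommutator G n, s • X - (i g - 1) ∈ rootSpan I i n) := by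
    intro s X hX
    obtain ⟨k, rfl⟩ := ZMod.natCast_zmod_surjective s
    rw [Nat.cast_smul_eq_nsmul]
    induction k with
    | zero => exact ⟨1, one_mem _, by simp⟩
    | succ k ih => rw [succ_nsmul]; exact hadd _ _ ih hX
  induction hX using Submodule.span_induction with
  | mem y hy =>
    obtain ⟨q, hq, b, rfl⟩ := hy
    obtain ⟨s, hs⟩ := h.exists_sub_mem b
    have e : (i q - 1) * b = s • (i q - 1) + (i q - 1) * (b - s • 1) := by
      rw [mul_sub, mul_smul_comm, mul_one]; abel
    rw [e]
    refine hadd _ _ (hsmul s _ ⟨q, hq, by simp⟩) ⟨1, one_mem _, ?_⟩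
    rw [map_one, sub_self, sub_zero]
    exact Submodule.subset_span ⟨q, hq, _, hs, rfl⟩
  | zero => exact ⟨1, one_mem _, by simp⟩
  | add x y _ _ hx hy => exact hadd x y hx hy
  | smul s x _ hx => exact hsmul s x hx

include h hi in
-- Since `(j k - 1) ^ p ^ e = j (k ^ p ^ e) - 1 ∈ M`, the root hypothesis puts `j k - i g` in
-- `rootSpan` for some `g`. Multiplying by `i g⁻¹` keeps it there, which bounds the order of `w`.
-- This bound is what allows factors chosen on generators to extend to a homomorphism.
theorem exists_factor [Fact p.Prime] [CharP A p]
    (hroot : ∀ (e : ℕ) (a : A), (a - 1) ^ p ^ e ∈ M → a - 1 ∈ Submodule.span (ZMod p)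
      {y | ∃ q ∈ rootsOfCommutator G (p ^ e), ∃ b : A, (i q - 1) * b = y})
    (e : ℕ) {k : H} (hk : k ^ p ^ e ∈ commutator H) :
    ∃ (g : G) (w : A), j k = i g * w ∧ w - 1 ∈ I * I ∧ w ^ p ^ e = 1 := by
  have h1 : (j k - 1) ^ p ^ e ∈ M := by
    rw [sub_pow_char_pow_of_commute _ _ (Commute.one_right _), one_pow, ← map_pow]
    exact h.commutator_sub_one_mem j hk
  obtain ⟨g, -, hg⟩ := h.exists_sub_mem_rootSpan hi _ (hroot e _ h1)
  have h2 := h.rootSpan_conj _ g⁻¹ hg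
  have e1 : i g * (i g⁻¹ * j k) = j k := by rw [← mul_assoc, ← map_mul]; simp
  have e2 : i g⁻¹ * (j k - 1 - (i g - 1)) = i g⁻¹ * j k - 1 := by
    rw [sub_sub_sub_cancel_right, mul_sub, ← map_mul i, inv_mul_cancel, map_one]
  rw [e2] at h2
  refine ⟨g, i g⁻¹ * j k, e1.symm, rootSpan_le hi _ h2, ?_⟩
  have h3 := h.pow_eq_zero_of_mem_rootSpan hi e h2
  rwa [sub_pow_char_pow_of_commute _ _ (Commute.one_right _), one_pow, sub_eq_zero] at h3

include h hi in
/-- Every group basis factors, through a homomorphism to `1 + I * I`, over the image of another. -/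
theorem exists_factor_hom [Fact p.Prime] [CharP A p] [Finite H] (hH : IsPGroup p H)
    (hroot : ∀ (e : ℕ) (a : A), (a - 1) ^ p ^ e ∈ M → a - 1 ∈ Submodule.span (ZMod p)
      {y | ∃ q ∈ rootsOfCommutator G (p ^ e), ∃ b : A, (i q - 1) * b = y}) :
    ∃ w : H →* A, (∀ k, w k - 1 ∈ I * I) ∧ (∀ k ∈ commutator H, w k = 1) ∧
      ∀ k, ∃ g, j k = i g * w k := by
  let _ := h.unitsOneAddSqCommGroup
  -- The relation "some representative of the class lies in `i(G) * u`". It is a subgroup because `1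
  -- + I * I` normalises `i(G)`.
  let S : AddSubgroup (Additive (Abelianization H) × Additive h.unitsOneAddSq) :=
    { carrier := {x | ∃ (k : H) (g : G), Additive.ofMul (Abelianization.of k) = x.1 ∧
        j k = i g * ((x.2.toMul : Aˣ) : A)}
      zero_mem' := ⟨1, 1, by simp, by simp⟩
      add_mem' := by
        rintro x y ⟨k, g, hk, hg⟩ ⟨k', g', hk', hg'⟩
        obtain ⟨g'', hs⟩ := h.exists_swap hi x.2.toMul.2 g'
        refine ⟨k * k', g * g'', ?_, ?_⟩
        · rw [map_mul, ofMul_mul, hk, hk']; rfl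
        · rw [map_mul, hg, hg', map_mul]
          calc _ = i g * (((x.2.toMul : Aˣ) : A) * i g') * ((y.2.toMul : Aˣ) : A) := by noncomm_ring
            _ = _ := by rw [hs]; simp [mul_assoc]
      neg_mem' := by
        rintro x ⟨k, g, hk, hg⟩
        obtain ⟨g'', hs⟩ := h.exists_swap hi (-x.2).toMul.2 g⁻¹
        refine ⟨k⁻¹, g'', ?_, ?_⟩
        · rw [map_inv, ofMul_inv, hk]; rfl
        · have e1 : j k * (((-x.2).toMul : Aˣ) * i g⁻¹) = 1 := by
            rw [hg]
            calc _ = i g * ((((x.2.toMul * (-x.2).toMul : h.unitsOneAddSq)) : Aˣ) : A) * i g⁻¹ := by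
                  simp [mul_assoc]
              _ = 1 := by simp [← map_mul]
          have e2 : j k⁻¹ * j k = 1 := by rw [← map_mul]; simp
          rw [Prod.snd_neg, ← hs]
          calc j k⁻¹ = j k⁻¹ * (j k * (((-x.2).toMul : Aˣ) * i g⁻¹)) := by rw [e1, mul_one]
            _ = _ := by rw [← mul_assoc, e2, one_mul] }
  obtain ⟨f, hf⟩ := S.exists_addMonoidHom_forall_mem (by
    intro x
    obtain ⟨k, hk⟩ : ∃ k, Abelianization.of k = x.toMul := QuotientGroup.mk_surjective x.toMul
    have hP : IsPGroup p (Abelianization H) := hH.to_quotient _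
    obtain ⟨e, he⟩ := (IsPGroup.iff_orderOf.1 hP) x.toMul
    have hke : k ^ p ^ e ∈ commutator H := by
      rw [← Abelianization.ker_of, MonoidHom.mem_ker, map_pow, hk, ← he, pow_orderOf_eq_one]
    obtain ⟨g, w, h1, h2, h3⟩ := h.exists_factor hi (j := j) hroot e hke
    have hpos : p ^ e ≠ 0 := (pow_pos (Fact.out : p.Prime).pos e).ne'
    let u : Aˣ := Units.ofPowEqOne w (p ^ e) h3 hpos
    refine ⟨Additive.ofMul ⟨u, h2⟩, ⟨k, g, ?_, h1⟩, ?_⟩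
    · exact congrArg Additive.ofMul hk
    · have : addOrderOf x = p ^ e := by rw [← he]; rfl
      rw [this, ← ofMul_pow]
      refine congrArg Additive.ofMul (Subtype.ext (Units.ext ?_))
      exact h3)
  let w : H →* A := (Units.coeHom A).comp (h.unitsOneAddSq.subtype.comp
    (MonoidHom.mk' (fun k => (f (Additive.ofMul (Abelianization.of k))).toMul)
      fun a b => by rw [map_mul, ofMul_mul, map_add, toMul_add]))
  have hw : ∀ k, w k = (((f (Additive.ofMul (Abelianization.of k))).toMul : Aˣ) : A) := fun k => rfl
  refine ⟨w, fun k => (f (Additive.ofMul (Abelianization.of k))).toMul.2, fun k hk => ?_,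
    fun k => ?_⟩
  · have : Abelianization.of k = 1 := by
      rw [← MonoidHom.mem_ker, Abelianization.ker_of]; exact hk
    rw [hw, this]; simp
  · obtain ⟨k', g, h1, h2⟩ := hf (Additive.ofMul (Abelianization.of k))
    rw [← hw] at h2
    -- The relation speaks only of some `k'` in the class of `k`. The discrepancy lies in `H'`,
    -- whose image is contained in `1 + M = i(G')`, and is absorbed into `g`.
    have hx : k * k'⁻¹ ∈ commutator H := by
      rw [← Abelianization.ker_of, MonoidHom.mem_ker, map_mul, map_inv,
        Additive.ofMul.injective h1, mul_inv_cancel]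
    obtain ⟨x, -, hx'⟩ := hi.exists_commutator _ (h.commutator_sub_one_mem j hx)
    refine ⟨x * g, ?_⟩
    rw [map_mul, hx', add_sub_cancel, mul_assoc, ← h2, ← map_mul]
    simp

end IsSmallAlgebra

/-! ### Symmetrizing a biadditive map -/

/-- The kernel of a map to an additive group that turns products into sums. -/
def addKer {H V : Type*} [Group H] [AddCommGroup V] (d : H → V)
    (hd : ∀ x y, d (x * y) = d x + d y) : Subgroup H where
  carrier := {x | d x = 0}
  mul_mem' := fun {x y} hx hy => by
    have hx : d x = 0 := hx
    have hy : d y = 0 := hy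
    rw [Set.mem_ofPred_eq, hd, hx, hy, add_zero]
  one_mem' := by simpa using hd 1 1
  inv_mem' := fun {x} hx => by
    have hx : d x = 0 := hx
    have h1 : d 1 = 0 := by simpa using hd 1 1
    have := hd x x⁻¹
    rw [mul_inv_cancel, h1, hx, zero_add] at this
    exact this.symm

theorem eq_zero_of_addKer_eq_top {H V : Type*} [Group H] [AddCommGroup V] {d : H → V}
    {hd : ∀ x y, d (x * y) = d x + d y} (h : addKer d hd = ⊤) (x : H) : d x = 0 := by
  have : x ∈ addKer d hd := h ▸ Subgroup.mem_top x
  exact this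

/-- A biadditive map becomes symmetric after adding a suitable `l x • θ y`. -/
theorem exists_symmetrization {p : ℕ} [Fact p.Prime] {H V : Type*} [Group H] [AddCommGroup V]
    [Module (ZMod p) V] {θ : H → V} (hθ : ∀ x y, θ (x * y) = θ x + θ y) {β : H → H → V}
    (hβl : ∀ x y z, β (x * y) z = β x z + β y z) (hβr : ∀ x y z, β x (y * z) = β x y + β x z)
    {a b : H → ZMod p} (ha : ∀ x y, a (x * y) = a x + a y) (hb : ∀ x y, b (x * y) = b x + b y)
    {h₁ h₂ : H} (ha₁ : a h₁ = 1) (ha₂ : a h₂ = 0) (hb₁ : b h₁ = 0) (hb₂ : b h₂ = 1)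
    {Z : Subgroup H} (hgen : ∀ S : Subgroup H, h₁ ∈ S → h₂ ∈ S → Z ≤ S → S = ⊤)
    (haZ : ∀ z ∈ Z, a z = 0) (hbZ : ∀ z ∈ Z, b z = 0) (hθZ : ∀ z ∈ Z, θ z = 0)
    (hβZ : ∀ x, ∀ z ∈ Z, β x z = 0) (hμ : ∀ z ∈ Z, ∃ μ : ZMod p, ∀ y, β z y = μ • θ y)
    {r s : ZMod p} (hrs : β h₁ h₂ - β h₂ h₁ = r • θ h₁ + s • θ h₂) :
    ∃ l : H → ZMod p, (∀ x y, l (x * y) = l x + l y) ∧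
      ∀ x y, β x y + l x • θ y = β y x + l y • θ x := by
  -- The coefficient of `β z` along `θ` is read off by a functional at one point where `θ ≠ 0`; the
  -- same formula is additive on all of `H`.
  obtain ⟨κ, hκ, hκZ⟩ : ∃ κ : H → ZMod p, (∀ x y, κ (x * y) = κ x + κ y) ∧
      ∀ z ∈ Z, ∀ y, β z y = κ z • θ y := by
    by_cases h0 : ∀ k, θ k = 0
    · refine ⟨fun _ => 0, by simp, fun z hz y => ?_⟩
      obtain ⟨μ, hμ⟩ := hμ z hz
      rw [hμ, h0, smul_zero, smul_zero]
    · push Not at h0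
      obtain ⟨k, hk⟩ := h0
      obtain ⟨f, hf⟩ : ∃ f : Module.Dual (ZMod p) V, f (θ k) ≠ 0 := by
        by_contra! h
        exact hk ((Module.forall_dual_apply_eq_zero_iff (ZMod p) _).1 h)
      refine ⟨fun x => (f (θ k))⁻¹ * f (β x k), fun x y => ?_, fun z hz y => ?_⟩
      · simp only [hβl, map_add, mul_add]
      · obtain ⟨μ, hμ⟩ := hμ z hz
        simp only [hμ, map_smul, smul_eq_mul]
        rw [mul_comm μ, inv_mul_cancel_left₀ hf]
  -- Chosen so that `l h₁ = -s` and `l h₂ = r`, cancelling the antisymmetric part at `(h₁, h₂)`,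
  -- while `l = -κ` on `Z`.
  let l : H → ZMod p := fun x => a x * (-s) + b x * r - (κ x - a x * κ h₁ - b x * κ h₂)
  have hl : ∀ x y, l (x * y) = l x + l y := by
    intro x y
    simp only [l, ha, hb, hκ]; ring
  have hl₁ : l h₁ = -s := by simp [l, ha₁, hb₁]
  have hl₂ : l h₂ = r := by simp [l, ha₂, hb₂]
  have hlZ : ∀ z ∈ Z, l z = -κ z := fun z hz => by simp [l, haZ z hz, hbZ z hz]
  -- The defect of symmetry is biadditive and alternating, so it vanishes once it does so on the
  -- generators `h₁`, `h₂` and `Z`.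
  let D : H → H → V := fun x y => (β x y + l x • θ y) - (β y x + l y • θ x)
  have hD : ∀ y x x', D (x * x') y = D x y + D x' y := by
    intro y x x'
    simp only [D, hβl, hβr, hl, hθ, add_smul, smul_add]; abel
  have hDs : ∀ x y, D x y = 0 → D y x = 0 := by
    intro x y h
    simp only [D] at h ⊢
    rw [← neg_sub, h, neg_zero]
  have hDr : ∀ x, D x x = 0 := fun x => by simp [D]
  have hD21 : D h₂ h₁ = 0 := by
    have : D h₂ h₁ = (r • θ h₁ + s • θ h₂) - (β h₁ h₂ - β h₂ h₁) := by
      simp only [D, hl₁, hl₂, neg_smul]; abel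
    rw [this, hrs, sub_self]
  have hDZ : ∀ y, ∀ z ∈ Z, D z y = 0 := by
    intro y z hz
    simp only [D, hκZ z hz y, hlZ z hz, hθZ z hz, hβZ y z hz, neg_smul, smul_zero]; abel
  have h1 : ∀ x, D x h₁ = 0 := fun x => by
    have := hgen (addKer (fun x => D x h₁) (hD h₁)) (hDr h₁) hD21 (fun z hz => hDZ h₁ z hz)
    exact eq_zero_of_addKer_eq_top this x
  have h2 : ∀ x, D x h₂ = 0 := fun x => by
    have := hgen (addKer (fun x => D x h₂) (hD h₂)) (hDs _ _ hD21) (hDr h₂)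
      (fun z hz => hDZ h₂ z hz)
    exact eq_zero_of_addKer_eq_top this x
  refine ⟨l, hl, fun x y => ?_⟩
  have := hgen (addKer (fun x => D x y) (hD y)) (hDs _ _ (h1 y)) (hDs _ _ (h2 y))
    (fun z hz => hDZ y z hz)
  exact sub_eq_zero.1 (eq_zero_of_addKer_eq_top this x)

/-! ### The images of `Φ(G)Z(G)` and the generation of `M` -/

namespace IsSmallAlgebra

variable {p : ℕ} {A : Type*} [Ring A] [Algebra (ZMod p) A]
  {I M : Submodule (ZMod p) A} (h : IsSmallAlgebra I M) {G H : Type*} [Group G] [Group H]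
  {i : G →* A} (hi : IsBasisHom I M i) {j : H →* A} (hj : IsBasisHom I M j)

include h hi in
-- Elements "central plus `M`" are closed under products. They include `p`-th powers, as `i y ^ p =
-- 1 + (i y - 1) ^ p` is central by `pow_char_comm`, as well as commutators and central elements,
-- and these generate `Φ(G)Z(G)`.
theorem exists_central_add [Fact p.Prime] [CharP A p] (hp3 : 3 ≤ p) [Finite G]
    (hcen : ∀ z ∈ Subgroup.center G, ∀ a : A, i z * a = a * i z) {z : G}
    (hz : z ∈ frattini G ⊔ Subgroup.center G) :
    ∃ ζ : A, ∃ m ∈ M, i z = ζ + m ∧ ∀ a, ζ * a = a * ζ := by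
  let S : Submonoid G :=
    { carrier := {z | ∃ ζ : A, ∃ m ∈ M, i z = ζ + m ∧ ∀ a, ζ * a = a * ζ}
      one_mem' := ⟨1, 0, zero_mem _, by simp, by simp⟩
      mul_mem' := by
        rintro x y ⟨ζ, m, hm, hx, hζ⟩ ⟨ζ', m', hm', hy, hζ'⟩
        refine ⟨ζ * ζ', ζ * m' + m * i y, add_mem (h.mul_mem_left' _ _ hm') (h.mul_mem_right' _ hm),
          ?_, fun a => ?_⟩
        · rw [map_mul, hx, hy]; noncomm_ring
        · rw [mul_assoc, hζ', ← mul_assoc, hζ, mul_assoc] }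
  have hle : frattini G ⊔ Subgroup.center G ≤ Subgroup.closure (S : Set G) := by
    refine sup_le ((frattini_le_powSubgroup_sup_commutator (p := p)).trans (sup_le ?_ ?_)) ?_
    · refine Subgroup.closure_mono ?_
      rintro _ ⟨y, -, rfl⟩
      refine ⟨1 + (i y - 1) ^ p, 0, zero_mem _, ?_, fun a => ?_⟩
      · rw [sub_pow_char_of_commute _ (Commute.one_right _), one_pow, ← map_pow]; simp
      · rw [add_mul, mul_add, h.pow_char_comm hp3 (hi.sub_one_mem y)]; simp
    · exact fun x hx => Subgroup.subset_closure
        ⟨1, i x - 1, h.commutator_sub_one_mem i hx, by simp, by simp⟩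
    · exact fun x hx => Subgroup.subset_closure ⟨i x, 0, zero_mem _, by simp, hcen x hx⟩
  have h1 := hle hz
  -- In a finite group inverses are powers, so closure under products suffices.
  rw [← Subgroup.mem_toSubmonoid, Subgroup.closure_toSubmonoid_of_finite, Submonoid.closure_eq] at h1
  exact h1

include h hj in
/-- If `H` is generated by `h₁`, `h₂` and its center, then `M` is generated by the commutator of
`h₁` and `h₂`. -/
theorem exists_mul_eq [Finite H] (hcen : ∀ z ∈ Subgroup.center H, ∀ a : A, j z * a = a * j z)
    {h₁ h₂ : H} (hgen : ∀ S : Subgroup H, h₁ ∈ S → h₂ ∈ S → Subgroup.center H ≤ S → S = ⊤)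
    {m : A} (hm : m ∈ M) : ∃ a, m = a * (j h₁ * j h₂ - j h₂ * j h₁) := by
  set c := j h₁ * j h₂ - j h₂ * j h₁ with hc
  have hcM : c ∈ M := h.comm _ _
  -- Since `b` is a scalar modulo `I` and `c * I = 0`, the left ideal `A * c` is two-sided.
  have hright : ∀ a b : A, ∃ a', a * c * b = a' * c := by
    intro a b
    obtain ⟨s, hs⟩ := h.exists_sub_mem b
    have := h.mul_eq_zero c hcM _ hs
    rw [mul_sub, sub_eq_zero, mul_smul_comm, mul_one] at this
    exact ⟨s • a, by rw [mul_assoc, this, mul_smul_comm, smul_mul_assoc]⟩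
  -- The elements commuting with `b` modulo `A * c`. Checking generators in one argument and then in
  -- the other shows that all of `j(H)` commutes modulo `A * c`.
  let S : A → Subgroup H := fun b =>
    { carrier := {k | ∃ a, j k * b - b * j k = a * c}
      one_mem' := ⟨0, by simp⟩
      mul_mem' := by
        rintro x y ⟨a, hx⟩ ⟨a', hy⟩
        obtain ⟨a'', ha⟩ := hright a (j y)
        refine ⟨j x * a' + a'', ?_⟩
        have e : j (x * y) * b - b * j (x * y) =
            j x * (j y * b - b * j y) + (j x * b - b * j x) * j y := by
          rw [map_mul]; noncomm_ring
        rw [e, hx, hy, ha]; noncomm_ring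
      inv_mem' := by
        rintro x ⟨a, hx⟩
        obtain ⟨a', ha⟩ := hright a (j x⁻¹)
        refine ⟨-(j x⁻¹ * a'), ?_⟩
        have e1 : j x⁻¹ * j x = 1 := by rw [← map_mul]; simp
        have e2 : j x * j x⁻¹ = 1 := by rw [← map_mul]; simp
        have e : j x⁻¹ * b - b * j x⁻¹ = -(j x⁻¹ * ((j x * b - b * j x) * j x⁻¹)) := by
          calc _ = j x⁻¹ * b * (j x * j x⁻¹) - (j x⁻¹ * j x) * b * j x⁻¹ := by rw [e1, e2]; simp
            _ = _ := by noncomm_ring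
        rw [e, hx, ha]; noncomm_ring }
  have hS : ∀ k b, k ∈ S b ↔ ∃ a, j k * b - b * j k = a * c := fun k b => Iff.rfl
  have hcenS : ∀ b, Subgroup.center H ≤ S b := by
    intro b z hz
    exact ⟨0, by rw [hcen z hz]; simp⟩
  have hsymm : ∀ k k', k ∈ S (j k') → k' ∈ S (j k) := by
    rintro k k' ⟨a, ha⟩
    exact ⟨-a, by rw [← neg_sub, ha, neg_mul]⟩
  have h12 : h₁ ∈ S (j h₂) := ⟨1, by rw [one_mul]⟩
  have hself : ∀ k, k ∈ S (j k) := fun k => ⟨0, by simp⟩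
  have hS1 : S (j h₁) = ⊤ := hgen _ (hself _) (hsymm _ _ h12) (hcenS _)
  have hS2 : S (j h₂) = ⊤ := hgen _ h12 (hself _) (hcenS _)
  have hSall : ∀ k k', k ∈ S (j k') := by
    intro k k'
    have : S (j k') = ⊤ := hgen _ (hsymm _ _ (hS1 ▸ Subgroup.mem_top k'))
      (hsymm _ _ (hS2 ▸ Subgroup.mem_top k')) (hcenS _)
    exact this ▸ Subgroup.mem_top k
  obtain ⟨x, hx, hxm⟩ := hj.exists_commutator m hm
  have hcl : ∀ x ∈ commutator H, ∃ a, j x - 1 = a * c := by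
    intro x hx
    rw [commutator_eq_closure] at hx
    induction hx using Subgroup.closure_induction with
    | mem x hx =>
      obtain ⟨k, k', rfl⟩ := hx
      obtain ⟨a, ha⟩ := (hS _ _).1 (hSall k k')
      rw [map_commutatorElement_sub_one, ha]
      exact hright _ _
    | one => exact ⟨0, by simp⟩
    | mul x y _ _ hx hy =>
      obtain ⟨a, ha⟩ := hx
      obtain ⟨b, hb⟩ := hy
      refine ⟨j x * b + a, ?_⟩
      have : j (x * y) - 1 = j x * (j y - 1) + (j x - 1) := by rw [map_mul]; noncomm_ring
      rw [this, ha, hb]; noncomm_ring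
    | inv x _ hx =>
      obtain ⟨a, ha⟩ := hx
      refine ⟨-(j x⁻¹ * a), ?_⟩
      have : j x⁻¹ - 1 = -(j x⁻¹ * (j x - 1)) := by rw [mul_sub, ← map_mul]; simp
      rw [this, ha]; noncomm_ring
  obtain ⟨a, ha⟩ := hcl x hx
  exact ⟨a, by rw [← ha, hxm]; abel⟩

end IsSmallAlgebra

/-! ### Straightening the factorisation to a homomorphism -/

namespace IsSmallAlgebra

variable {p : ℕ} {A : Type*} [Ring A] [Algebra (ZMod p) A]
  {I M : Submodule (ZMod p) A} (h : IsSmallAlgebra I M) {G H : Type*} [Group G] [Group H]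
  {i : G →* A} (hi : IsBasisHom I M i) {j : H →* A} (hj : IsBasisHom I M j)

include h hj in
-- Moving `w x⁻¹` past `j y` costs minus the bracket of `w x` with `j y`, by additivity; the outer
-- factors act trivially on that term.
theorem mul_add_bracket (w : H →* A) (hw : ∀ k, w k - 1 ∈ I * I) (x y : H) :
    j x * w x⁻¹ * (j y * w y⁻¹) = j (x * y) * w (x * y)⁻¹ - (w x * j y - j y * w x) := by
  have hinv : w x⁻¹ * j y - j y * w x⁻¹ = -(w x * j y - j y * w x) := by
    have := h.bracket_mul_left (hw x) (hw x⁻¹) (j y)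
    rw [← map_mul w, mul_inv_cancel, map_one, one_mul, mul_one, sub_self] at this
    exact eq_neg_of_add_eq_zero_right this.symm
  have hB := h.bracket_mem (hw x) (j y)
  have e : w x⁻¹ * j y = j y * w x⁻¹ - (w x * j y - j y * w x) := by
    rw [sub_eq_add_neg (j y * w x⁻¹), ← hinv]; abel
  calc j x * w x⁻¹ * (j y * w y⁻¹) = j x * (w x⁻¹ * j y) * w y⁻¹ := by noncomm_ring
    _ = j x * j y * (w x⁻¹ * w y⁻¹) - j x * (w x * j y - j y * w x) * w y⁻¹ := by
        rw [e]; noncomm_ring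
    _ = _ := by
        rw [h.mul_eq_self_of_mem_mul (hj.sub_one_mem x) hB,
          h.mul_eq_self (h.mem_of_mem_mul hB) (h.sq_le (hw _)), h.one_comm (hw x⁻¹) (hw y⁻¹),
          ← map_mul, ← map_mul, mul_inv_rev]

include h hi hj in
/-- A factorisation with symmetric brackets can be straightened to a homomorphism. -/
theorem exists_hom_of_symmetric [Fact p.Prime] (hp3 : 3 ≤ p) (w : H →* A)
    (hw : ∀ k, w k - 1 ∈ I * I)
    (hwc : ∀ k ∈ commutator H, w k = 1) (hwG : ∀ k, ∃ g, j k = i g * w k)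
    (hsymm : ∀ x y, w x * j y - j y * w x = w y * j x - j x * w y) :
    ∃ f : H →* A, (∀ k ∈ commutator H, f k = j k) ∧ (∀ k, f k - j k ∈ I * I) ∧
      ∀ k, ∃ g, f k = i g := by
  have h2 : (2 : ZMod p) ≠ 0 := by
    have : ((2 : ℕ) : ZMod p) ≠ 0 := by
      rw [Ne, ZMod.natCast_eq_zero_iff]
      exact fun hd => by have := Nat.le_of_dvd two_pos hd; omega
    simpa using this
  let β : H → H → A := fun x y => w x * j y - j y * w x
  have hβm : ∀ x y, β x y ∈ I * M := fun x y => h.bracket_mem (hw x) (j y)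
  -- Minus half the quadratic form of `β`: for symmetric `β` its deviation from additivity is
  -- exactly `-β x y`, which cancels the defect of `ρ`.
  let s : H → A := fun x => -((2 : ZMod p)⁻¹ • β x x)
  have hs : ∀ x, s x ∈ I * M := fun x => neg_mem (Submodule.smul_mem _ _ (hβm x x))
  have hsM : ∀ x, s x ∈ M := fun x => h.mem_of_mem_mul (hs x)
  have hβl : ∀ x y z, β (x * y) z = β x z + β y z := fun x y z => by
    simp only [β, map_mul w]
    exact h.bracket_mul_left (hw x) (hw y) _
  have hβr : ∀ x y z, β x (y * z) = β x y + β x z := fun x y z => by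
    simp only [β, map_mul j]
    exact h.bracket_mul_right (hw x) (hj.sub_one_mem y) (hj.sub_one_mem z)
  have hsadd : ∀ x y, s (x * y) = s x + s y - β x y := by
    intro x y
    have e : (2 : ZMod p)⁻¹ • β x y + (2 : ZMod p)⁻¹ • β x y = β x y := by
      rw [← two_smul (ZMod p), smul_smul, mul_inv_cancel₀ h2, one_smul]
    have e' : β y x = β x y := (hsymm x y).symm
    have : s (x * y) = s x + s y - ((2 : ZMod p)⁻¹ • β x y + (2 : ZMod p)⁻¹ • β x y) := by
      simp only [s, hβl, hβr, smul_add, e']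
      abel
    rw [this, e]
  let ρ : H → A := fun k => j k * w k⁻¹
  have hρ : ∀ x y, ρ x * ρ y = ρ (x * y) - β x y := fun x y => h.mul_add_bracket hj w hw x y
  have hρ1 : ∀ x, ρ x - 1 ∈ I := fun x =>
    h.mul_sub_one_mem (hj.sub_one_mem x) (h.sq_le (hw x⁻¹))
  have hβ1 : ∀ x ∈ commutator H, β x x = 0 := fun x hx => by simp [β, hwc x hx]
  let f : H →* A :=
    { toFun := fun k => ρ k + s k
      map_one' := by simp [ρ, s, β]
      map_mul' := by
        intro x y
        have e1 : ρ x * s y = s y := h.mul_eq_self_of_mem_mul (hρ1 x) (hs y)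
        have e2 : s x * ρ y = s x := h.mul_eq_self (hsM x) (hρ1 y)
        have e3 : s x * s y = 0 := h.mul_eq_zero _ (hsM x) _ (h.le (hsM y))
        rw [mul_add, add_mul, add_mul, hρ, e1, e2, e3, hsadd]
        abel }
  have hf : ∀ k, f k = j k * w k⁻¹ + s k := fun k => rfl
  refine ⟨f, fun k hk => ?_, fun k => ?_, fun k => ?_⟩
  · rw [hf, hwc _ (inv_mem hk)]
    simp only [s, hβ1 k hk]
    simp
  · have e : f k - j k = j k * (w k⁻¹ - 1) + s k := by rw [hf]; noncomm_ring
    rw [e]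
    exact add_mem (h.sq_mul_mem_left _ (hw _)) (h.mul_le_sq (hs k))
  · obtain ⟨g, hg⟩ := hwG k
    obtain ⟨x, -, hx⟩ := hi.exists_commutator _ (hsM k)
    refine ⟨g * x, ?_⟩
    rw [hf, hg, mul_assoc, ← map_mul, mul_inv_cancel, map_one, mul_one, map_mul, hx, mul_add,
      mul_one, h.mul_eq_self_of_mem_mul (hi.sub_one_mem g) (hs k)]

include h hi hj in
/-- Twisting a factorisation by an additive character. -/
theorem exists_twist [Fact p.Prime] (w : H →* A) (hw : ∀ k, w k - 1 ∈ I * I)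
    (hwc : ∀ k ∈ commutator H, w k = 1) (hwG : ∀ k, ∃ g, j k = i g * w k)
    {l : H → ZMod p} (hl : ∀ x y, l (x * y) = l x + l y) {c : A} (hc : c ∈ M) :
    ∃ w' : H →* A, (∀ k, w' k - 1 ∈ I * I) ∧ (∀ k ∈ commutator H, w' k = 1) ∧
      (∀ k, ∃ g, j k = i g * w' k) ∧
      ∀ x y, w' x * j y - j y * w' x = (w x * j y - j y * w x) + l x • ((j y - 1) * c) := by
  have hlc : ∀ k, l k • c ∈ M := fun k => Submodule.smul_mem _ _ hc
  -- Still multiplicative: `1 + I * I` fixes `M` under multiplication from either side, and `M * M =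
  -- 0`.
  let w' : H →* A :=
    { toFun := fun k => w k - l k • c
      map_one' := by
        have : l 1 = 0 := by simpa using hl 1 1
        simp [this]
      map_mul' := by
        intro x y
        have e1 : w x * (l y • c) = l y • c := h.sq_mul_eq_self (hlc y) (hw x)
        have e2 : (l x • c) * w y = l x • c := h.mul_eq_self (hlc x) (h.sq_le (hw y))
        have e3 : (l x • c) * (l y • c) = 0 := h.mul_eq_zero _ (hlc x) _ (h.le (hlc y))
        rw [mul_sub, sub_mul, sub_mul, e1, e2, e3, map_mul, hl, add_smul]
        abel }
  have hw' : ∀ k, w' k = w k - l k • c := fun k => rfl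
  have hlcomm : ∀ k ∈ commutator H, l k = 0 := by
    have : commutator H ≤ addKer l hl := by
      rw [commutator_eq_closure, Subgroup.closure_le]
      rintro _ ⟨x, y, rfl⟩
      change l ⁅x, y⁆ = 0
      have h1 : l 1 = 0 := by simpa using hl 1 1
      have hinv : ∀ x, l x⁻¹ = -l x := fun x => by
        have := hl x x⁻¹
        rw [mul_inv_cancel, h1] at this
        exact eq_neg_of_add_eq_zero_right this.symm
      rw [commutatorElement_def, hl, hl, hl, hinv, hinv]
      ring
    exact this
  refine ⟨w', fun k => ?_, fun k hk => ?_, fun k => ?_, fun x y => ?_⟩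
  · rw [hw', sub_right_comm]
    exact sub_mem (hw k) (h.le_sq (hlc k))
  · rw [hw', hwc k hk, hlcomm k hk, zero_smul, sub_zero]
  · obtain ⟨g, hg⟩ := hwG k
    obtain ⟨x, -, hx⟩ := hi.exists_commutator _ (hlc k)
    refine ⟨g * x, ?_⟩
    have e2 : (l k • c) * w k = l k • c := h.mul_eq_self (hlc k) (h.sq_le (hw k))
    have e3 : (l k • c) * (l k • c) = 0 := h.mul_eq_zero _ (hlc k) _ (h.le (hlc k))
    rw [map_mul, hx, hw', mul_assoc, add_mul, one_mul, mul_sub, e2, e3, hg]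
    congr 1; abel
  · have e : (l x • c) * j y = l x • c := h.mul_eq_self (hlc x) (hj.sub_one_mem y)
    rw [hw', sub_mul, mul_sub, e, mul_smul_comm, sub_mul, one_mul, smul_sub]
    abel

include h hi hj in
-- The core of the argument: the factorisation is twisted by a multiple of the single commutator `c`
-- until its bracket is symmetric. The hypothesis `hZ` controls the first argument of the bracket on
-- `Φ(H)Z(H)`.
theorem exists_hom [Fact p.Prime] [CharP A p] (hp3 : 3 ≤ p) [Finite G] [Finite H]
    (hH : IsPGroup p H)
    (hcenG : ∀ z ∈ Subgroup.center G, ∀ a : A, i z * a = a * i z)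
    (hcenH : ∀ z ∈ Subgroup.center H, ∀ a : A, j z * a = a * j z)
    (hroot : ∀ (e : ℕ) (a : A), (a - 1) ^ p ^ e ∈ M → a - 1 ∈ Submodule.span (ZMod p)
      {y | ∃ q ∈ rootsOfCommutator G (p ^ e), ∃ b : A, (i q - 1) * b = y})
    (hZ : ∀ (g : G) (k : H), k ∈ frattini H ⊔ Subgroup.center H → j k - i g ∈ I * I →
      g ∈ frattini G ⊔ Subgroup.center G)
    {a b : H → ZMod p} (ha : ∀ x y, a (x * y) = a x + a y) (hb : ∀ x y, b (x * y) = b x + b y)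
    {h₁ h₂ : H} (ha₁ : a h₁ = 1) (ha₂ : a h₂ = 0) (hb₁ : b h₁ = 0) (hb₂ : b h₂ = 1)
    (hab : ∀ x, (a x = 0 ∧ b x = 0) ↔ x ∈ frattini H ⊔ Subgroup.center H) :
    ∃ f : H →* A, (∀ k ∈ commutator H, f k = j k) ∧ (∀ k, f k - j k ∈ I * I) ∧
      ∀ k, ∃ g, f k = i g := by
  obtain ⟨w, hw, hwc, hwG⟩ := h.exists_factor_hom hi (j := j) hH hroot
  set Z := frattini H ⊔ Subgroup.center H with hZdef
  have hgen : ∀ S : Subgroup H, h₁ ∈ S → h₂ ∈ S → Z ≤ S → S = ⊤ := by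
    intro S hS1 hS2 hZS
    rw [eq_top_iff]
    intro x _
    have hpow : ∀ (d : H → ZMod p), (∀ x y, d (x * y) = d x + d y) → ∀ x (n : ℕ),
        d (x ^ n) = n * d x := by
      intro d hd x n
      induction n with
      | zero => simpa using hd 1 1
      | succ n ih => rw [pow_succ, hd, ih]; push_cast; ring
    have hinv : ∀ (d : H → ZMod p), (∀ x y, d (x * y) = d x + d y) → ∀ x y,
        d (x⁻¹ * y) = d y - d x := by
      intro d hd x y
      rw [eq_sub_iff_add_eq, add_comm, ← hd, mul_inv_cancel_left]
    have hmem : h₁ ^ (a x).val * h₂ ^ (b x).val ∈ S :=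
      mul_mem (pow_mem hS1 _) (pow_mem hS2 _)
    have : (h₁ ^ (a x).val * h₂ ^ (b x).val)⁻¹ * x ∈ Z := by
      rw [← hab, hinv a ha, hinv b hb, ha, hb]
      simp [hpow a ha, hpow b hb, ha₁, ha₂, hb₁, hb₂]
    have := mul_mem hmem (hZS this)
    rwa [mul_inv_cancel_left] at this
  -- The Frattini subgroup consists of non-generators, so the center alone suffices.
  have hgen' : ∀ S : Subgroup H, h₁ ∈ S → h₂ ∈ S → Subgroup.center H ≤ S → S = ⊤ := by
    intro S hS1 hS2 hcS
    refine frattini_nongenerating (hgen _ ?_ ?_ ?_)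
    · exact Subgroup.mem_sup_left hS1
    · exact Subgroup.mem_sup_left hS2
    · exact sup_le le_sup_right (hcS.trans le_sup_left)
  set c := j h₁ * j h₂ - j h₂ * j h₁ with hc
  have hcM : c ∈ M := h.comm _ _
  let θ : H → A := fun k => (j k - 1) * c
  have hθm : ∀ k, θ k ∈ I * M := fun k => Submodule.mul_mem_mul (hj.sub_one_mem k) hcM
  have hθ : ∀ x y, θ (x * y) = θ x + θ y := by
    intro x y
    have e : θ (x * y) = j x * θ y + θ x := by simp only [θ, map_mul]; noncomm_ring
    rw [e, h.mul_eq_self_of_mem_mul (hj.sub_one_mem x) (hθm y), add_comm]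
  let β : H → H → A := fun x y => w x * j y - j y * w x
  have hβm : ∀ x y, β x y ∈ I * M := fun x y => h.bracket_mem (hw x) (j y)
  have hβl : ∀ x y z, β (x * y) z = β x z + β y z := fun x y z => by
    simp only [β, map_mul w]
    exact h.bracket_mul_left (hw x) (hw y) _
  have hβr : ∀ x y z, β x (y * z) = β x y + β x z := fun x y z => by
    simp only [β, map_mul j]
    exact h.bracket_mul_right (hw x) (hj.sub_one_mem y) (hj.sub_one_mem z)
  -- With `j z = ζ + m`, `ζ` central, left and right multiplication of `c` by `j z` agree, and `c *
  -- j z = c`.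
  have hθZ : ∀ z ∈ Z, θ z = 0 := by
    intro z hz
    obtain ⟨ζ, m, hm, hjz, hζ⟩ := h.exists_central_add hj hp3 hcenH hz
    have e1 : m * c = 0 := h.mul_eq_zero m hm c (h.le hcM)
    have e2 : c * m = 0 := h.mul_eq_zero c hcM m (h.le hm)
    have e3 : c * j z = c := h.mul_eq_self hcM (hj.sub_one_mem z)
    simp only [θ]
    rw [hjz, sub_mul, add_mul, e1, hζ, one_mul, add_zero, sub_eq_zero]
    rwa [hjz, mul_add, e2, add_zero] at e3
  have hβZ : ∀ x, ∀ z ∈ Z, β x z = 0 := by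
    intro x z hz
    obtain ⟨ζ, m, hm, hjz, hζ⟩ := h.exists_central_add hj hp3 hcenH hz
    simp only [β]
    rw [hjz, mul_add, add_mul, h.sq_mul_eq_self hm (hw x), h.mul_eq_self hm (h.sq_le (hw x)), hζ,
      sub_self]
  -- Both `j z` and `i g⁻¹` are central plus `M`, hence so is `w z`. Only its `M`-part `q * c`
  -- contributes to the bracket, giving `-(j y - 1) * q * c`, and `q` may be replaced by its scalar
  -- part.
  have hμ : ∀ z ∈ Z, ∃ μ : ZMod p, ∀ y, β z y = μ • θ y := by
    intro z hz
    obtain ⟨ζ, m, hm, hjz, hζ⟩ := h.exists_central_add hj hp3 hcenH hz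
    obtain ⟨g, hg⟩ := hwG z
    have hgZ : g ∈ frattini G ⊔ Subgroup.center G := by
      refine hZ g z hz ?_
      have : j z - i g = i g * (w z - 1) := by rw [hg]; noncomm_ring
      rw [this]
      exact h.sq_mul_mem_left _ (hw z)
    obtain ⟨ζ', m', hm', hig, hζ'⟩ := h.exists_central_add hi hp3 hcenG (inv_mem hgZ)
    have hwz : w z = i g⁻¹ * j z := by rw [hg, ← mul_assoc, ← map_mul]; simp
    have hn : ζ' * m + m' * j z ∈ M := add_mem (h.mul_mem_left' _ _ hm) (h.mul_mem_right' _ hm')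
    have hwz' : w z = ζ' * ζ + (ζ' * m + m' * j z) := by
      rw [hwz, hig, hjz]; noncomm_ring
    obtain ⟨q, hq⟩ := h.exists_mul_eq hj hcenH hgen' hn
    rw [← hc] at hq
    obtain ⟨s, hs⟩ := h.exists_sub_mem q
    refine ⟨-s, fun y => ?_⟩
    have hcomm : ζ' * ζ * j y = j y * (ζ' * ζ) := by
      rw [mul_assoc, hζ, ← mul_assoc, hζ', mul_assoc]
    have e1 : (j y - 1) * ((q - s • 1) * c) = 0 :=
      h.mul_eq_zero_of_mem_mul (hj.sub_one_mem y) (Submodule.mul_mem_mul hs hcM)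
    have e2 : (j y - 1) * (q * c) = s • θ y := by
      rw [sub_mul q, mul_sub, sub_eq_zero] at e1
      rw [e1, smul_mul_assoc, one_mul, mul_smul_comm]
    simp only [β]
    rw [hwz', add_mul, mul_add, hcomm, h.mul_eq_self hn (hj.sub_one_mem y), hq, neg_smul, ← e2]
    noncomm_ring
  have hspan : ∀ t ∈ I * M, ∃ r s : ZMod p, t = r • θ h₁ + s • θ h₂ := by
    have hle : I * M ≤ Submodule.span (ZMod p) {θ h₁, θ h₂} := by
      have hθs : ∀ k, θ k ∈ Submodule.span (ZMod p) {θ h₁, θ h₂} := by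
        intro k
        let S : Subgroup H := (AddSubgroup.toSubgroup
          (Submodule.span (ZMod p) {θ h₁, θ h₂}).toAddSubgroup).comap
          (MonoidHom.mk' (fun k => Multiplicative.ofAdd (θ k)) (fun x y => by rw [hθ, ofAdd_add]))
        have hS : ∀ k, k ∈ S ↔ θ k ∈ Submodule.span (ZMod p) {θ h₁, θ h₂} := fun k => Iff.rfl
        have : S = ⊤ := hgen S ((hS _).2 (Submodule.subset_span (by simp)))
          ((hS _).2 (Submodule.subset_span (by simp)))
          (fun z hz => (hS _).2 (by rw [hθZ z hz]; exact zero_mem _))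
        rw [← hS, this]
        trivial
      -- For `m = q * c` one has `x * q ≡ j k - 1` modulo `I * I`, and `I * I` kills `c`; so `x * m
      -- = θ k`.
      refine Submodule.mul_le.2 fun x hx m hm => ?_
      obtain ⟨q, rfl⟩ := h.exists_mul_eq hj hcenH hgen' hm
      obtain ⟨k, hk⟩ := hj.exists_sub_mem_sq _ (h.mul_mem_right q x hx)
      have := h.sq_mul_eq_zero hk hcM
      rw [sub_mul, sub_eq_zero] at this
      rw [← mul_assoc, ← hc, this]
      exact hθs k
    intro t ht
    obtain ⟨r, s, hrs⟩ := Submodule.mem_span_pair.1 (hle ht)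
    exact ⟨r, s, hrs.symm⟩
  obtain ⟨r, s, hrs⟩ := hspan _ (sub_mem (hβm h₁ h₂) (hβm h₂ h₁))
  obtain ⟨l, hl, hsymm⟩ := exists_symmetrization hθ hβl hβr ha hb ha₁ ha₂ hb₁ hb₂ hgen
    (fun z hz => ((hab z).2 hz).1) (fun z hz => ((hab z).2 hz).2) hθZ hβZ hμ hrs
  obtain ⟨w', hw', hwc', hwG', hβ'⟩ := h.exists_twist hi hj w hw hwc hwG hl hcM
  exact h.exists_hom_of_symmetric hi hj hp3 w' hw' hwc' hwG' fun x y => by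
    rw [hβ', hβ']; exact hsymm x y

end IsSmallAlgebra

/-! ### Augmentation and commutator ideals of the group algebra -/

section GroupAlgebra

variable (p : ℕ) (G : Type*) [Group G]

/-- The augmentation of the group algebra. -/
noncomputable def augmentation : MonoidAlgebra (ZMod p) G →ₐ[ZMod p] ZMod p :=
  MonoidAlgebra.lift (ZMod p) (ZMod p) G 1

/-- The augmentation ideal of the group algebra. -/
noncomputable def augIdeal : Submodule (ZMod p) (MonoidAlgebra (ZMod p) G) :=
  LinearMap.ker (augmentation p G).toLinearMap

/-- The projection of the group algebra onto the group algebra of the abelianization. -/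
noncomputable def abelianizationMap :
    MonoidAlgebra (ZMod p) G →ₐ[ZMod p] MonoidAlgebra (ZMod p) (Abelianization G) :=
  MonoidAlgebra.mapDomainAlgHom (ZMod p) (ZMod p) Abelianization.of

/-- The kernel of the projection onto the group algebra of the abelianization. -/
noncomputable def commIdeal : Submodule (ZMod p) (MonoidAlgebra (ZMod p) G) :=
  LinearMap.ker (abelianizationMap p G).toLinearMap

/-- The ideal whose quotient is the small quotient of the group algebra that is used here. -/
noncomputable def smallIdeal : Submodule (ZMod p) (MonoidAlgebra (ZMod p) G) :=
  commIdeal p G * augIdeal p G ⊔ augIdeal p G * (augIdeal p G * commIdeal p G)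

variable {p G}

theorem mem_augIdeal {x : MonoidAlgebra (ZMod p) G} : x ∈ augIdeal p G ↔ augmentation p G x = 0 :=
  Iff.rfl

theorem mem_commIdeal {x : MonoidAlgebra (ZMod p) G} :
    x ∈ commIdeal p G ↔ abelianizationMap p G x = 0 :=
  Iff.rfl

@[simp]
theorem augmentation_of (g : G) : augmentation p G (MonoidAlgebra.of _ _ g) = 1 := by
  simp [augmentation]

@[simp]
theorem abelianizationMap_of (g : G) :
    abelianizationMap p G (MonoidAlgebra.of _ _ g) =
      MonoidAlgebra.of _ _ (Abelianization.of g) := by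
  simp [abelianizationMap]

theorem of_sub_one_mem_augIdeal (g : G) : MonoidAlgebra.of _ _ g - 1 ∈ augIdeal p G := by
  rw [mem_augIdeal, map_sub, augmentation_of, map_one, sub_self]

theorem of_inv_mul_of (g : G) :
    MonoidAlgebra.of (ZMod p) G g⁻¹ * MonoidAlgebra.of (ZMod p) G g = 1 := by
  rw [← map_mul, inv_mul_cancel, map_one]

theorem MonoidAlgebra.induction_span {P : MonoidAlgebra (ZMod p) G → Prop}
    (hof : ∀ g, P (MonoidAlgebra.of _ _ g)) (hadd : ∀ x y, P x → P y → P (x + y))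
    (hsmul : ∀ (s : ZMod p) x, P x → P (s • x)) (x : MonoidAlgebra (ZMod p) G) : P x := by
  induction x using MonoidAlgebra.induction_linear with
  | zero => simpa using hsmul 0 _ (hof 1)
  | add x y hx hy => exact hadd x y hx hy
  | single g s => simpa using hsmul s _ (hof g)

theorem sub_augmentation_mem_span (x : MonoidAlgebra (ZMod p) G) :
    x - augmentation p G x • 1 ∈
      Submodule.span (ZMod p) (Set.range fun g : G => MonoidAlgebra.of (ZMod p) G g - 1) := by
  induction x using MonoidAlgebra.induction_span with
  | hof g => rw [augmentation_of, one_smul]; exact Submodule.subset_span ⟨g, rfl⟩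
  | hadd x y hx hy =>
    have : x + y - augmentation p G (x + y) • 1 =
        (x - augmentation p G x • 1) + (y - augmentation p G y • 1) := by
      rw [map_add, add_smul]; abel
    rw [this]; exact add_mem hx hy
  | hsmul s x hx =>
    have : s • x - augmentation p G (s • x) • 1 = s • (x - augmentation p G x • 1) := by
      rw [map_smul, smul_sub, smul_assoc]
    rw [this]; exact Submodule.smul_mem _ _ hx

theorem augIdeal_eq_span : augIdeal p G =
    Submodule.span (ZMod p) (Set.range fun g : G => MonoidAlgebra.of (ZMod p) G g - 1) := by
  refine le_antisymm (fun x hx => ?_) (Submodule.span_le.2 ?_)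
  · have := sub_augmentation_mem_span x
    rwa [mem_augIdeal.1 hx, zero_smul, sub_zero] at this
  · rintro _ ⟨g, rfl⟩
    exact of_sub_one_mem_augIdeal g

theorem mul_mem_augIdeal_left (a : MonoidAlgebra (ZMod p) G) {x} (hx : x ∈ augIdeal p G) :
    a * x ∈ augIdeal p G := by
  rw [mem_augIdeal] at *; rw [map_mul, hx, mul_zero]

theorem mul_mem_augIdeal_right (a : MonoidAlgebra (ZMod p) G) {x} (hx : x ∈ augIdeal p G) :
    x * a ∈ augIdeal p G := by
  rw [mem_augIdeal] at *; rw [map_mul, hx, zero_mul]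

theorem mul_mem_commIdeal_left (a : MonoidAlgebra (ZMod p) G) {x} (hx : x ∈ commIdeal p G) :
    a * x ∈ commIdeal p G := by
  rw [mem_commIdeal] at *; rw [map_mul, hx, mul_zero]

theorem mul_mem_commIdeal_right (a : MonoidAlgebra (ZMod p) G) {x} (hx : x ∈ commIdeal p G) :
    x * a ∈ commIdeal p G := by
  rw [mem_commIdeal] at *; rw [map_mul, hx, zero_mul]

/-- Congruence modulo the square of the augmentation ideal is additive in group elements. -/
theorem exists_sub_mem_augIdeal_sq [Fact p.Prime] {x : MonoidAlgebra (ZMod p) G}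
    (hx : x ∈ augIdeal p G) :
    ∃ g : G, x - (MonoidAlgebra.of _ _ g - 1) ∈ augIdeal p G * augIdeal p G := by
  have hadd : ∀ X Y : MonoidAlgebra (ZMod p) G,
      (∃ g : G, X - (MonoidAlgebra.of _ _ g - 1) ∈ augIdeal p G * augIdeal p G) →
      (∃ g : G, Y - (MonoidAlgebra.of _ _ g - 1) ∈ augIdeal p G * augIdeal p G) →
      (∃ g : G, X + Y - (MonoidAlgebra.of _ _ g - 1) ∈ augIdeal p G * augIdeal p G) := by
    rintro X Y ⟨g, hX⟩ ⟨k, hY⟩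
    refine ⟨g * k, ?_⟩
    have e : X + Y - (MonoidAlgebra.of _ _ (g * k) - 1) =
        (X - (MonoidAlgebra.of _ _ g - 1)) + (Y - (MonoidAlgebra.of _ _ k - 1)) -
          (MonoidAlgebra.of (ZMod p) G g - 1) * (MonoidAlgebra.of _ _ k - 1) := by
      rw [map_mul]; noncomm_ring
    rw [e]
    exact sub_mem (add_mem hX hY)
      (Submodule.mul_mem_mul (of_sub_one_mem_augIdeal g) (of_sub_one_mem_augIdeal k))
  rw [augIdeal_eq_span] at hx
  induction hx using Submodule.span_induction with
  | mem x hx => obtain ⟨g, rfl⟩ := hx; exact ⟨g, by simp⟩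
  | zero => exact ⟨1, by rw [map_one, sub_self, sub_zero]; exact zero_mem _⟩
  | add x y _ _ hx hy => exact hadd x y hx hy
  | smul s x _ hx =>
    obtain ⟨k, rfl⟩ := ZMod.natCast_zmod_surjective s
    rw [Nat.cast_smul_eq_nsmul]
    induction k with
    | zero => exact ⟨1, by simp [-MonoidAlgebra.of_apply]⟩
    | succ k ih => rw [succ_nsmul]; exact hadd _ _ ih hx

/-- The kernel of the linear map induced by a map `f` of index sets is spanned by the differences of
elements with equal image. -/
theorem mem_span_of_mapDomain_eq_zero {Y : Type*} (f : G → Y) {x : MonoidAlgebra (ZMod p) G}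
    (hx : MonoidAlgebra.mapDomain f x = 0) :
    x ∈ Submodule.span (ZMod p) {y | ∃ g g' : G, f g = f g' ∧
      MonoidAlgebra.of (ZMod p) G g - MonoidAlgebra.of _ _ g' = y} := by
  classical
  -- A choice of representatives of the fibres; its values off the range of `f` play no role.
  let s : Y → G := Function.invFun f
  have hs : ∀ g, f (s (f g)) = f g := fun g => Function.invFun_eq ⟨g, rfl⟩
  have h1 : ∀ x : MonoidAlgebra (ZMod p) G,
      x - MonoidAlgebra.mapDomain s (MonoidAlgebra.mapDomain f x) ∈
      Submodule.span (ZMod p) {y | ∃ g g' : G, f g = f g' ∧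
        MonoidAlgebra.of (ZMod p) G g - MonoidAlgebra.of _ _ g' = y} := by
    intro x
    induction x using MonoidAlgebra.induction_span with
    | hof g =>
      refine Submodule.subset_span ⟨g, s (f g), (hs g).symm, ?_⟩
      simp
    | hadd x y hx hy =>
      rw [MonoidAlgebra.mapDomain_add, MonoidAlgebra.mapDomain_add, add_sub_add_comm]
      exact add_mem hx hy
    | hsmul a x hx =>
      rw [MonoidAlgebra.mapDomain_smul, MonoidAlgebra.mapDomain_smul, ← smul_sub]
      exact Submodule.smul_mem _ _ hx
  have := h1 x
  rwa [hx, MonoidAlgebra.mapDomain_zero, sub_zero] at this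

theorem commIdeal_eq_span : commIdeal p G = Submodule.span (ZMod p) {y | ∃ x ∈ commutator G, ∃ g : G,
    (MonoidAlgebra.of (ZMod p) G x - 1) * MonoidAlgebra.of _ _ g = y} := by
  refine le_antisymm (fun x hx => ?_) (Submodule.span_le.2 ?_)
  · have h1 := mem_span_of_mapDomain_eq_zero (Abelianization.of (G := G)) (mem_commIdeal.1 hx)
    refine Submodule.span_le.2 ?_ h1
    rintro _ ⟨g, g', hg, rfl⟩
    refine Submodule.subset_span ⟨g * g'⁻¹, ?_, g', ?_⟩
    · rw [← Abelianization.ker_of, MonoidHom.mem_ker, map_mul, map_inv, hg, mul_inv_cancel]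
    · rw [sub_mul, ← map_mul]; simp
  · rintro _ ⟨x, hx, g, rfl⟩
    rw [← Abelianization.ker_of, MonoidHom.mem_ker] at hx
    rw [SetLike.mem_coe, mem_commIdeal, map_mul, map_sub, abelianizationMap_of, hx, map_one,
      map_one, sub_self, zero_mul]

theorem bracket_mem_commIdeal (a b : MonoidAlgebra (ZMod p) G) : a * b - b * a ∈ commIdeal p G := by
  rw [mem_commIdeal, map_sub, map_mul, map_mul, mul_comm, sub_self]

theorem augmentation_abelianizationMap (x : MonoidAlgebra (ZMod p) G) :
    augmentation p _ (abelianizationMap p G x) = augmentation p G x := by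
  induction x using MonoidAlgebra.induction_span with
  | hof g => rw [abelianizationMap_of, augmentation_of, augmentation_of]
  | hadd x y hx hy => simp [hx, hy]
  | hsmul s x hx => simp [hx]

theorem commIdeal_le_augIdeal : commIdeal p G ≤ augIdeal p G := fun x hx => by
  rw [mem_augIdeal, ← augmentation_abelianizationMap, mem_commIdeal.1 hx, map_zero]

theorem augIdeal_sq_mul_mem_left (a : MonoidAlgebra (ZMod p) G) {u}
    (hu : u ∈ augIdeal p G * augIdeal p G) : a * u ∈ augIdeal p G * augIdeal p G := by
  induction hu using Submodule.mul_induction_on' with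
  | mem_mul_mem x hx y hy =>
    rw [← mul_assoc]; exact Submodule.mul_mem_mul (mul_mem_augIdeal_left a hx) hy
  | add x _ y _ hx hy => rw [mul_add]; exact add_mem hx hy

theorem augIdeal_sq_mul_mem_right (a : MonoidAlgebra (ZMod p) G) {u}
    (hu : u ∈ augIdeal p G * augIdeal p G) : u * a ∈ augIdeal p G * augIdeal p G := by
  induction hu using Submodule.mul_induction_on' with
  | mem_mul_mem x hx y hy =>
    rw [mul_assoc]; exact Submodule.mul_mem_mul hx (mul_mem_augIdeal_right a hy)
  | add x _ y _ hx hy => rw [add_mul]; exact add_mem hx hy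

/-- The subgroup of elements congruent to `1` modulo the square of the augmentation ideal. -/
def oneAddSqSubgroup (p : ℕ) (G : Type*) [Group G] : Subgroup G where
  carrier := {g | MonoidAlgebra.of (ZMod p) G g - 1 ∈ augIdeal p G * augIdeal p G}
  one_mem' := by simp [-MonoidAlgebra.of_apply]
  mul_mem' := fun {x y} hx hy => by
    have e : MonoidAlgebra.of (ZMod p) G (x * y) - 1 = MonoidAlgebra.of (ZMod p) G x *
        (MonoidAlgebra.of (ZMod p) G y - 1) + (MonoidAlgebra.of (ZMod p) G x - 1) := by
      rw [map_mul]; noncomm_ring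
    rw [Set.mem_ofPred_eq, e]
    exact add_mem (augIdeal_sq_mul_mem_left _ hy) hx
  inv_mem' := fun {x} hx => by
    have e : MonoidAlgebra.of (ZMod p) G x⁻¹ - 1 =
        -(MonoidAlgebra.of (ZMod p) G x⁻¹ * (MonoidAlgebra.of (ZMod p) G x - 1)) := by
      rw [mul_sub, of_inv_mul_of]; simp
    rw [Set.mem_ofPred_eq, e]
    exact neg_mem (augIdeal_sq_mul_mem_left _ hx)

theorem commutator_le_oneAddSqSubgroup : commutator G ≤ oneAddSqSubgroup p G := by
  rw [commutator_eq_closure, Subgroup.closure_le]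
  rintro _ ⟨a, b, rfl⟩
  change MonoidAlgebra.of (ZMod p) G ⁅a, b⁆ - 1 ∈ augIdeal p G * augIdeal p G
  have e : MonoidAlgebra.of (ZMod p) G a * MonoidAlgebra.of (ZMod p) G b -
      MonoidAlgebra.of (ZMod p) G b * MonoidAlgebra.of (ZMod p) G a =
      (MonoidAlgebra.of (ZMod p) G a - 1) * (MonoidAlgebra.of (ZMod p) G b - 1) -
        (MonoidAlgebra.of (ZMod p) G b - 1) * (MonoidAlgebra.of (ZMod p) G a - 1) := by
    noncomm_ring
  rw [map_commutatorElement_sub_one, e]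
  exact augIdeal_sq_mul_mem_right _ (sub_mem
    (Submodule.mul_mem_mul (of_sub_one_mem_augIdeal a) (of_sub_one_mem_augIdeal b))
    (Submodule.mul_mem_mul (of_sub_one_mem_augIdeal b) (of_sub_one_mem_augIdeal a)))

theorem commIdeal_le_sq : commIdeal p G ≤ augIdeal p G * augIdeal p G := by
  rw [commIdeal_eq_span, Submodule.span_le]
  rintro _ ⟨x, hx, g, rfl⟩
  exact augIdeal_sq_mul_mem_right _ (commutator_le_oneAddSqSubgroup hx)

theorem smallIdeal_le_commIdeal : smallIdeal p G ≤ commIdeal p G :=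
  sup_le (Submodule.mul_le.2 fun _ hx y _ => mul_mem_commIdeal_right y hx)
    (Submodule.mul_le.2 fun x _ _ hy => mul_mem_commIdeal_left x
      ((Submodule.mul_le.2 fun x _ _ hy => mul_mem_commIdeal_left x hy :
        augIdeal p G * commIdeal p G ≤ commIdeal p G) hy))

theorem smallIdeal_le_sq : smallIdeal p G ≤ augIdeal p G * augIdeal p G :=
  smallIdeal_le_commIdeal.trans commIdeal_le_sq

theorem mul_mem_smallIdeal_left (a : MonoidAlgebra (ZMod p) G) {x} (hx : x ∈ smallIdeal p G) :
    a * x ∈ smallIdeal p G := by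
  refine (sup_le (Submodule.mul_le.2 fun m hm y hy => ?_) (Submodule.mul_le.2 fun m hm y hy => ?_) :
    smallIdeal p G ≤ (smallIdeal p G).comap (LinearMap.mulLeft (ZMod p) a)) hx
  · rw [Submodule.mem_comap, LinearMap.mulLeft_apply, ← mul_assoc]
    exact Submodule.mem_sup_left (Submodule.mul_mem_mul (mul_mem_commIdeal_left _ hm) hy)
  · rw [Submodule.mem_comap, LinearMap.mulLeft_apply, ← mul_assoc]
    exact Submodule.mem_sup_right (Submodule.mul_mem_mul (mul_mem_augIdeal_left _ hm) hy)

theorem mul_mem_smallIdeal_right (a : MonoidAlgebra (ZMod p) G) {x} (hx : x ∈ smallIdeal p G) :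
    x * a ∈ smallIdeal p G := by
  refine (sup_le (Submodule.mul_le.2 fun m hm y hy => ?_) (Submodule.mul_le.2 fun m hm y hy => ?_) :
    smallIdeal p G ≤ (smallIdeal p G).comap (LinearMap.mulRight (ZMod p) a)) hx
  · rw [Submodule.mem_comap, LinearMap.mulRight_apply, mul_assoc]
    exact Submodule.mem_sup_left (Submodule.mul_mem_mul hm (mul_mem_augIdeal_right _ hy))
  · rw [Submodule.mem_comap, LinearMap.mulRight_apply, mul_assoc]
    refine Submodule.mem_sup_right (Submodule.mul_mem_mul hm ?_)
    refine (Submodule.mul_le.2 fun m hm y hy => ?_ : augIdeal p G * commIdeal p G ≤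
      (augIdeal p G * commIdeal p G).comap (LinearMap.mulRight (ZMod p) a)) hy
    rw [Submodule.mem_comap, LinearMap.mulRight_apply, mul_assoc]
    exact Submodule.mul_mem_mul hm (mul_mem_commIdeal_right _ hy)

/-- Frobenius is additive on a commutative algebra of characteristic `p` and fixes the scalars `ZMod
p`, so it is determined on group elements. -/
theorem frobenius_eq_mapDomain {Q : Type*} [CommGroup Q] [Fact p.Prime] (e : ℕ)
    (x : MonoidAlgebra (ZMod p) Q) : x ^ p ^ e = MonoidAlgebra.mapDomain (fun q => q ^ p ^ e) x := by
  have : CharP (MonoidAlgebra (ZMod p) Q) p :=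
    charP_of_injective_algebraMap (FaithfulSMul.algebraMap_injective (ZMod p) _) p
  induction x using MonoidAlgebra.induction_span with
  | hof g => rw [← map_pow]; simp
  | hadd x y hx hy => rw [add_pow_char_pow, hx, hy, MonoidAlgebra.mapDomain_add]
  | hsmul s x hx => rw [smul_pow, hx, MonoidAlgebra.mapDomain_smul, ZMod.pow_card_pow]

/-- Elements whose `p ^ e`-th power vanishes modulo the commutator ideal. -/
theorem mem_span_of_pow_mem_commIdeal [Fact p.Prime] (e : ℕ) {x : MonoidAlgebra (ZMod p) G}
    (hx : x ^ p ^ e ∈ commIdeal p G) : x ∈ Submodule.span (ZMod p)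
      {y | ∃ q ∈ rootsOfCommutator G (p ^ e), ∃ b,
        (MonoidAlgebra.of (ZMod p) G q - 1) * b = y} := by
  rw [mem_commIdeal, map_pow, frobenius_eq_mapDomain] at hx
  have h0 : MonoidAlgebra.mapDomain (fun g : G => (Abelianization.of g) ^ p ^ e) x = 0 := by
    rw [← hx]
    generalize x = y
    induction y using MonoidAlgebra.induction_span with
    | hof g => rw [abelianizationMap_of]; simp
    | hadd x y hx hy => rw [map_add, MonoidAlgebra.mapDomain_add, MonoidAlgebra.mapDomain_add, hx, hy]
    | hsmul s x hx =>
      rw [map_smul, MonoidAlgebra.mapDomain_smul, MonoidAlgebra.mapDomain_smul, hx]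
  refine Submodule.span_le.2 ?_ (mem_span_of_mapDomain_eq_zero _ h0)
  rintro _ ⟨g, g', hg, rfl⟩
  refine Submodule.subset_span ⟨g * g'⁻¹, ?_, MonoidAlgebra.of _ _ g', ?_⟩
  · rw [rootsOfCommutator, MonoidHom.mem_ker]
    rw [MonoidHom.comp_apply, powMonoidHom_apply, map_mul, map_inv, mul_pow, inv_pow, hg,
      mul_inv_cancel]
  · rw [sub_mul, ← map_mul]; simp

end GroupAlgebra

/-! ### The index of `Φ(G)Z(G)` from the center of the group algebra -/

/-- On a finite `p`-group, the sum of a class function that vanishes on the center is zero modulo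
`p`. -/
theorem sum_eq_zero_of_conj_invariant {p : ℕ} [hp : Fact p.Prime] {G V : Type*} [Group G]
    [Fintype G] (hG : IsPGroup p G) [AddCommGroup V] [Module (ZMod p) V] (u : G → V)
    (hu : ∀ k g, u (k * g * k⁻¹) = u g) (hz : ∀ z ∈ Subgroup.center G, u z = 0) :
    ∑ g, u g = 0 := by
  classical
  have h1 : ∑ g, u g = ∑ v ∈ Finset.univ.image u, (Finset.univ.filter fun g => u g = v).card • v :=
    Finset.sum_comp (fun v => v) u
  rw [h1]
  refine Finset.sum_eq_zero fun v _ => ?_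
  by_cases hv : v = 0
  · rw [hv, smul_zero]
  -- For `v ≠ 0` conjugation acts on this fibre without fixed points, since those would be central;
  -- hence `p` divides its size.
  let _ : MulAction G {g // u g = v} :=
    { smul := fun k g => ⟨k * g.1 * k⁻¹, (hu k g.1).trans g.2⟩
      one_smul := fun g => Subtype.ext (by change 1 * g.1 * 1⁻¹ = g.1; simp)
      mul_smul := fun a b g => Subtype.ext (by
        change a * b * g.1 * (a * b)⁻¹ = a * (b * g.1 * b⁻¹) * a⁻¹
        simp [mul_assoc]) }
  have h2 := hG.card_modEq_card_fixedPoints {g // u g = v}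
  have h3 : IsEmpty (MulAction.fixedPoints G {g // u g = v}) := by
    refine ⟨fun ⟨g, hg⟩ => hv ?_⟩
    rw [← g.2]
    refine hz _ (Subgroup.mem_center_iff.2 fun k => ?_)
    have : k * g.1 * k⁻¹ = g.1 := congrArg Subtype.val (hg k)
    exact mul_inv_eq_iff_eq_mul.1 this
  have h4 : Nat.card (MulAction.fixedPoints G {g // u g = v}) = 0 := Nat.card_of_isEmpty
  rw [h4, Nat.modEq_zero_iff_dvd, Nat.card_eq_fintype_card,
    Fintype.card_subtype] at h2
  rw [← Nat.cast_smul_eq_nsmul (ZMod p), (ZMod.natCast_eq_zero_iff _ _).2 h2, zero_smul]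

section

variable {p : ℕ} {G : Type*} [Group G]

/-- The linear extension of a function on the group to the group algebra. -/
noncomputable def linearExtension {V : Type*} [AddCommGroup V] [Module (ZMod p) V] (v : G → V) :
    MonoidAlgebra (ZMod p) G →ₗ[ZMod p] V :=
  Finsupp.linearCombination (ZMod p) v ∘ₗ (MonoidAlgebra.coeffLinearEquiv (ZMod p)).toLinearMap

theorem linearExtension_of {V : Type*} [AddCommGroup V] [Module (ZMod p) V] (v : G → V) (g : G) :
    linearExtension v (MonoidAlgebra.of (ZMod p) G g) = v g := by
  simp [linearExtension]

omit [Group G] in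
theorem linearExtension_apply [Fintype G] {V : Type*} [AddCommGroup V] [Module (ZMod p) V]
    (v : G → V) (x : MonoidAlgebra (ZMod p) G) : linearExtension v x = ∑ g, x.coeff g • v g := by
  simp [linearExtension, Finsupp.linearCombination_apply, Finsupp.sum_fintype]

theorem linearExtension_eq_zero_of_mem_sq {V : Type*} [AddCommGroup V] [Module (ZMod p) V]
    {v : G → V} (hv : ∀ x y, v (x * y) = v x + v y) {x : MonoidAlgebra (ZMod p) G}
    (hx : x ∈ augIdeal p G * augIdeal p G) : linearExtension v x = 0 := by
  have h1 : v 1 = 0 := by simpa using hv 1 1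
  have : augIdeal p G * augIdeal p G ≤ LinearMap.ker (linearExtension v) := by
    rw [augIdeal_eq_span, Submodule.span_mul_span, Submodule.span_le]
    rintro _ ⟨_, ⟨g, rfl⟩, _, ⟨k, rfl⟩, rfl⟩
    have e : (MonoidAlgebra.of (ZMod p) G g - 1) * (MonoidAlgebra.of (ZMod p) G k - 1) =
        MonoidAlgebra.of (ZMod p) G (g * k) - MonoidAlgebra.of (ZMod p) G g -
        MonoidAlgebra.of (ZMod p) G k + MonoidAlgebra.of (ZMod p) G 1 := by
      rw [map_mul, map_one]; noncomm_ring
    change linearExtension v ((MonoidAlgebra.of (ZMod p) G g - 1) *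
      (MonoidAlgebra.of (ZMod p) G k - 1)) = 0
    rw [e]
    simp only [map_add, map_sub, linearExtension_of, hv, h1]
    abel
  exact this hx

/-- The coefficients of a central element and the additive map `v` are both constant on conjugacy
classes, so the sum runs over a class function vanishing on `Z(G)`. -/
theorem linearExtension_eq_zero_of_mem_center [Fact p.Prime] [Finite G] (hG : IsPGroup p G)
    {V : Type*} [AddCommGroup V] [Module (ZMod p) V]
    {v : G → V} (hv : ∀ x y, v (x * y) = v x + v y) (hz : ∀ z ∈ Subgroup.center G, v z = 0)
    {x : MonoidAlgebra (ZMod p) G} (hx : ∀ a, x * a = a * x) : linearExtension v x = 0 := by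
  have := Fintype.ofFinite G
  rw [linearExtension_apply]
  refine sum_eq_zero_of_conj_invariant hG _ (fun k g => ?_) (fun z h => by rw [hz z h, smul_zero])
  have h1 : v 1 = 0 := by simpa using hv 1 1
  have h2 : v (k * g * k⁻¹) = v g := by
    have := hv k k⁻¹
    rw [mul_inv_cancel, h1] at this
    rw [hv, hv, add_right_comm, ← this, zero_add]
  have h3 := congrArg (fun y => y.coeff (k * g)) (hx (MonoidAlgebra.of (ZMod p) G k))
  simp only [MonoidAlgebra.of_apply, MonoidAlgebra.coeff_mul_single_apply,
    MonoidAlgebra.coeff_single_mul_apply, one_mul, mul_one, inv_mul_cancel_left] at h3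
  rw [h2, h3]

variable (p G) in
/-- The sum of the center of the group algebra and the square of its augmentation ideal. -/
noncomputable def centerAddSq : Submodule (ZMod p) (MonoidAlgebra (ZMod p) G) :=
  Subalgebra.toSubmodule (Subalgebra.center (ZMod p) (MonoidAlgebra (ZMod p) G)) ⊔
    augIdeal p G * augIdeal p G

theorem of_mem_center {z : G} (hz : z ∈ Subgroup.center G) (a : MonoidAlgebra (ZMod p) G) :
    MonoidAlgebra.of (ZMod p) G z * a = a * MonoidAlgebra.of (ZMod p) G z :=
  MonoidAlgebra.of_commute (fun m => (Subgroup.mem_center_iff.1 hz m).symm) a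

theorem one_mem_centerAddSq : (1 : MonoidAlgebra (ZMod p) G) ∈ centerAddSq p G :=
  Submodule.mem_sup_left (one_mem (Subalgebra.center (ZMod p) (MonoidAlgebra (ZMod p) G)))

variable (p G) in
/-- The map from the group to the quotient of its group algebra by `centerAddSq`. -/
noncomputable def toQuotient : G →* Multiplicative (MonoidAlgebra (ZMod p) G ⧸ centerAddSq p G) :=
  MonoidHom.mk' (fun g => Multiplicative.ofAdd
    ((centerAddSq p G).mkQ (MonoidAlgebra.of (ZMod p) G g))) fun x y => by
    rw [← ofAdd_add, ← map_add]
    refine congrArg Multiplicative.ofAdd ((Submodule.Quotient.eq _).2 ?_)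
    have e : MonoidAlgebra.of (ZMod p) G (x * y) -
        (MonoidAlgebra.of (ZMod p) G x + MonoidAlgebra.of (ZMod p) G y) =
        (MonoidAlgebra.of (ZMod p) G x - 1) * (MonoidAlgebra.of (ZMod p) G y - 1) - 1 := by
      rw [map_mul]; noncomm_ring
    rw [e]
    exact sub_mem (Submodule.mem_sup_right (Submodule.mul_mem_mul (of_sub_one_mem_augIdeal x)
      (of_sub_one_mem_augIdeal y))) one_mem_centerAddSq

theorem mem_ker_toQuotient {g : G} :
    g ∈ (toQuotient p G).ker ↔ MonoidAlgebra.of (ZMod p) G g ∈ centerAddSq p G := by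
  rw [MonoidHom.mem_ker, toQuotient, MonoidHom.mk'_apply, ofAdd_eq_one, Submodule.mkQ_apply,
    Submodule.Quotient.mk_eq_zero]

theorem toQuotient_surjective [Fact p.Prime] : Function.Surjective (toQuotient p G) := by
  intro x
  obtain ⟨y, hy⟩ := (centerAddSq p G).mkQ_surjective x.toAdd
  have h0 : y - augmentation p G y • 1 ∈ augIdeal p G := by simp [mem_augIdeal]
  obtain ⟨g, hg⟩ := exists_sub_mem_augIdeal_sq h0
  refine ⟨g, ?_⟩
  have : toQuotient p G g = Multiplicative.ofAdd ((centerAddSq p G).mkQ y) := by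
    refine congrArg Multiplicative.ofAdd ((Submodule.Quotient.eq _).2 ?_)
    have e : MonoidAlgebra.of (ZMod p) G g - y =
        -(y - augmentation p G y • 1 - (MonoidAlgebra.of (ZMod p) G g - 1)) + 1 -
          augmentation p G y • 1 := by abel
    rw [e]
    exact sub_mem (add_mem (neg_mem (Submodule.mem_sup_right hg)) one_mem_centerAddSq)
      (Submodule.smul_mem _ _ one_mem_centerAddSq)
  rw [this, hy]; rfl

theorem frattini_le_oneAddSqSubgroup [hp : Fact p.Prime] [Finite G] :
    frattini G ≤ oneAddSqSubgroup p G := by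
  have : CharP (MonoidAlgebra (ZMod p) G) p :=
    charP_of_injective_algebraMap (FaithfulSMul.algebraMap_injective (ZMod p) _) p
  refine (frattini_le_powSubgroup_sup_commutator (p := p)).trans
    (sup_le ((Subgroup.closure_le _).2 ?_) commutator_le_oneAddSqSubgroup)
  rintro _ ⟨y, -, rfl⟩
  change MonoidAlgebra.of (ZMod p) G (y ^ p) - 1 ∈ augIdeal p G * augIdeal p G
  have e : MonoidAlgebra.of (ZMod p) G (y ^ p) - 1 = (MonoidAlgebra.of (ZMod p) G y - 1) ^ p := by
    rw [sub_pow_char_of_commute _ (Commute.one_right _), one_pow, map_pow]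
  obtain ⟨k, hk⟩ : ∃ k, p = k + 2 := ⟨p - 2, by have := hp.out.two_le; omega⟩
  have e2 : (MonoidAlgebra.of (ZMod p) G y - 1) ^ p = (MonoidAlgebra.of (ZMod p) G y - 1) ^ k *
      ((MonoidAlgebra.of (ZMod p) G y - 1) * (MonoidAlgebra.of (ZMod p) G y - 1)) := by
    rw [← pow_two, ← pow_add, ← hk]
  rw [e, e2]
  exact augIdeal_sq_mul_mem_left _
    (Submodule.mul_mem_mul (of_sub_one_mem_augIdeal y) (of_sub_one_mem_augIdeal y))

/-- An additive map with kernel `Φ(G)Z(G)` extends linearly to a map killing both `Z(FG)` and the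
squared augmentation ideal, which bounds the kernel from above. Conversely `Φ(G)` is congruent to
`1` modulo that square. -/
theorem ker_toQuotient [Fact p.Prime] [Finite G] (hG : IsPGroup p G) :
    (toQuotient p G).ker = frattini G ⊔ Subgroup.center G := by
  refine le_antisymm (fun g hg => ?_) (sup_le (fun x hx => ?_) (fun x hx => ?_))
  · rw [mem_ker_toQuotient] at hg
    obtain ⟨V, _, _, d, hd, hker⟩ := exists_module_hom (p := p) (frattini G ⊔ Subgroup.center G)
      ((commutator_le_frattini hG).trans le_sup_left)
      (fun x => Subgroup.mem_sup_left (pow_mem_frattini hG x))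
    have hle : centerAddSq p G ≤ LinearMap.ker (linearExtension d) := by
      refine sup_le (fun x hx => ?_) (fun x hx => linearExtension_eq_zero_of_mem_sq hd hx)
      refine linearExtension_eq_zero_of_mem_center hG hd
        (fun z hz => (hker z).2 (Subgroup.mem_sup_right hz)) fun a => ?_
      exact ((Subalgebra.mem_center_iff (R := ZMod p)).1 hx a).symm
    rw [← hker, ← linearExtension_of (p := p) d]
    exact hle hg
  · rw [mem_ker_toQuotient]
    have := frattini_le_oneAddSqSubgroup (p := p) hx
    have h2 := add_mem (Submodule.mem_sup_right this :
      MonoidAlgebra.of (ZMod p) G x - 1 ∈ centerAddSq p G) one_mem_centerAddSq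
    rwa [sub_add_cancel] at h2
  · rw [mem_ker_toQuotient]
    exact Submodule.mem_sup_left ((Subalgebra.mem_center_iff (R := ZMod p)).2 fun a => (of_mem_center hx a).symm)

theorem card_quotient_centerAddSq [Fact p.Prime] [Finite G] (hG : IsPGroup p G) :
    Nat.card (MonoidAlgebra (ZMod p) G ⧸ centerAddSq p G) =
      Nat.card (G ⧸ (frattini G ⊔ Subgroup.center G)) := by
  change _ = Subgroup.index _
  rw [← ker_toQuotient hG, Subgroup.index_ker,
    MonoidHom.range_eq_top.2 (toQuotient_surjective (p := p) (G := G)), Subgroup.card_top]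
  rfl

/-- The quotient by `centerAddSq` is two-dimensional; `h₁`, `h₂` lift a basis and `a`, `b` are its
coordinates. -/
theorem exists_coordinates [hp : Fact p.Prime] [Finite G] (hG : IsPGroup p G)
    (hcard : Nat.card (G ⧸ (frattini G ⊔ Subgroup.center G)) = p ^ 2) :
    ∃ (a b : G → ZMod p) (h₁ h₂ : G), (∀ x y, a (x * y) = a x + a y) ∧
      (∀ x y, b (x * y) = b x + b y) ∧ a h₁ = 1 ∧ a h₂ = 0 ∧ b h₁ = 0 ∧ b h₂ = 1 ∧
      ∀ x, (a x = 0 ∧ b x = 0) ↔ x ∈ frattini G ⊔ Subgroup.center G := by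
  rw [← card_quotient_centerAddSq hG] at hcard
  have hfin : Finite (MonoidAlgebra (ZMod p) G ⧸ centerAddSq p G) :=
    Nat.finite_of_card_ne_zero (by rw [hcard]; exact (pow_pos hp.out.pos 2).ne')
  have hrank : Module.finrank (ZMod p) (MonoidAlgebra (ZMod p) G ⧸ centerAddSq p G) = 2 := by
    have := Module.natCard_eq_pow_finrank (K := ZMod p)
      (V := MonoidAlgebra (ZMod p) G ⧸ centerAddSq p G)
    rw [hcard, Nat.card_zmod] at this
    exact (Nat.pow_right_injective hp.out.two_le this).symm
  let B := Module.finBasisOfFinrankEq (ZMod p) _ hrank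
  let d : G → MonoidAlgebra (ZMod p) G ⧸ centerAddSq p G := fun g => (toQuotient p G g).toAdd
  have hd : ∀ x y, d (x * y) = d x + d y := fun x y => by simp [d]
  have hsurj : ∀ v, ∃ g, d g = v := fun v => by
    obtain ⟨g, hg⟩ := toQuotient_surjective (Multiplicative.ofAdd v)
    exact ⟨g, by simp [d, hg]⟩
  obtain ⟨h₁, hh₁⟩ := hsurj (B 0)
  obtain ⟨h₂, hh₂⟩ := hsurj (B 1)
  refine ⟨fun g => B.repr (d g) 0, fun g => B.repr (d g) 1, h₁, h₂, fun x y => by simp [hd],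
    fun x y => by simp [hd], by simp [hh₁], by simp [hh₂], by simp [hh₁], by simp [hh₂],
    fun x => ?_⟩
  have h0 : x ∈ frattini G ⊔ Subgroup.center G ↔ d x = 0 := by
    rw [← ker_toQuotient hG, MonoidHom.mem_ker]; rfl
  rw [h0, ← B.repr.map_eq_zero_iff, Finsupp.ext_iff, Fin.forall_fin_two]
  rfl

end

/-! ### The kernel of the map from the group to the small quotient -/

theorem lowerCentral_two (G : Type*) [Group G] : lowerCentral G 2 = commutator G :=
  Subgroup.top_lowerCentralSeries_one

theorem lowerCentral_three (G : Type*) [Group G] :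
    lowerCentral G 3 = ⁅commutator G, (⊤ : Subgroup G)⁆ := by
  rw [← lowerCentral_two]; rfl

theorem lowerCentral_four (G : Type*) [Group G] :
    lowerCentral G 4 = ⁅lowerCentral G 3, (⊤ : Subgroup G)⁆ := rfl

theorem lowerCentral_four_le_commutator (G : Type*) [Group G] :
    lowerCentral G 4 ≤ commutator G := by
  rw [← lowerCentral_two]
  exact Subgroup.lowerCentralSeries_antitone _ (by norm_num)

theorem gammaTwoPowGammaFour_le_commutator (p : ℕ) (G : Type*) [Group G] :
    gammaTwoPowGammaFour p G ≤ commutator G := by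
  refine sup_le ((Subgroup.closure_le _).2 ?_) (lowerCentral_four_le_commutator G)
  rintro _ ⟨y, hy, rfl⟩
  rw [lowerCentral_two] at hy
  exact pow_mem hy p

/-- The three subgroups lemma, applied modulo `γ₄`. -/
theorem commutator_commutator_le_lowerCentral_four (G : Type*) [Group G] :
    ⁅commutator G, commutator G⁆ ≤ lowerCentral G 4 := by
  set q := QuotientGroup.mk' (lowerCentral G 4) with hq
  have hker : q.ker = lowerCentral G 4 := QuotientGroup.ker_mk' _
  have h1 : ⁅⁅(commutator G).map q, (⊤ : Subgroup G).map q⁆, (⊤ : Subgroup G).map q⁆ = ⊥ := by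
    rw [← Subgroup.map_commutator, ← Subgroup.map_commutator, ← lowerCentral_three,
      ← lowerCentral_four, Subgroup.map_eq_bot_iff, hker]
  have h2 : ⁅⁅(⊤ : Subgroup G).map q, (⊤ : Subgroup G).map q⁆, (commutator G).map q⁆ = ⊥ :=
    Subgroup.commutator_commutator_eq_bot_of_rotate
      (by rw [Subgroup.commutator_comm ((⊤ : Subgroup G).map q)]; exact h1) h1
  rw [← Subgroup.map_commutator, ← commutator_def, ← Subgroup.map_commutator,
    Subgroup.map_eq_bot_iff, hker] at h2
  exact h2

namespace IsSmallAlgebra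

variable {p : ℕ} {A : Type*} [Ring A] [Algebra (ZMod p) A]
  {I M : Submodule (ZMod p) A} (h : IsSmallAlgebra I M) {G : Type*} [Group G]
  {i : G →* A} (hi : IsBasisHom I M i)

include h hi in
theorem map_commutatorElement (a b : G) : i ⁅a, b⁆ - 1 = i a * i b - i b * i a := by
  rw [map_commutatorElement_sub_one, h.mul_eq_self (h.comm _ _) (hi.sub_one_mem _)]

include h hi in
theorem bracket_eq {a : A} (ha : a - 1 ∈ M) (b : G) :
    a * i b - i b * a = -((i b - 1) * (a - 1)) := by
  have e : a * i b - i b * a = (a - 1) * (i b - 1) - (i b - 1) * (a - 1) := by noncomm_ring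
  rw [e, h.mul_eq_zero _ ha _ (hi.sub_one_mem b), zero_sub]

include h hi in
theorem sub_one_mem_of_mem_lowerCentral_three {x : G} (hx : x ∈ lowerCentral G 3) :
    i x - 1 ∈ I * M := by
  rw [lowerCentral_three, Subgroup.commutator_def] at hx
  induction hx using Subgroup.closure_induction with
  | mem x hx =>
    obtain ⟨a, ha, b, -, rfl⟩ := hx
    have ha' := h.commutator_sub_one_mem i ha
    rw [h.map_commutatorElement hi, h.bracket_eq hi ha']
    exact neg_mem (Submodule.mul_mem_mul (hi.sub_one_mem b) ha')
  | one => simp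
  | mul x y _ _ hx hy =>
    have : i (x * y) - 1 = i x * (i y - 1) + (i x - 1) := by rw [map_mul]; noncomm_ring
    rw [this]; exact add_mem (h.mul_mul_mem_left _ hy) hx
  | inv x _ hx =>
    have : i x⁻¹ - 1 = -(i x⁻¹ * (i x - 1)) := by rw [mul_sub, ← map_mul]; simp
    rw [this]; exact neg_mem (h.mul_mul_mem_left _ hx)

include h hi in
-- For `y ∈ G'` already `(i y - 1) ^ 2 ∈ M * I = 0`, so `i y ^ p = 1`. Each further commutator
-- multiplies by `I` on the left, so `γ₃` lands in `1 + I * M` and `γ₄` in `1 + I * I * M = 1`.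
theorem map_eq_one [hp : Fact p.Prime] [CharP A p] {x : G} (hx : x ∈ gammaTwoPowGammaFour p G) :
    i x = 1 := by
  rw [← MonoidHom.mem_ker]
  refine (sup_le ((Subgroup.closure_le _).2 ?_) ?_ : gammaTwoPowGammaFour p G ≤ i.ker) hx
  · rintro _ ⟨y, hy, rfl⟩
    rw [lowerCentral_two] at hy
    have hm := h.commutator_sub_one_mem i hy
    have e : (i y - 1) ^ p = 0 := by
      obtain ⟨k, hk⟩ : ∃ k, p = k + 2 := ⟨p - 2, by have := hp.out.two_le; omega⟩
      have : (i y - 1) ^ p = (i y - 1) ^ k * ((i y - 1) * (i y - 1)) := by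
        rw [← pow_two, ← pow_add, ← hk]
      rw [this, h.mul_eq_zero _ hm _ (h.le hm), mul_zero]
    rw [sub_pow_char_of_commute _ (Commute.one_right _), one_pow, sub_eq_zero, ← map_pow] at e
    exact e
  · rw [lowerCentral_four, Subgroup.commutator_def, Subgroup.closure_le]
    rintro _ ⟨a, ha, b, -, rfl⟩
    have ha' := h.sub_one_mem_of_mem_lowerCentral_three hi ha
    have := h.map_commutatorElement hi a b
    rw [h.bracket_eq hi (h.mem_of_mem_mul ha'),
      h.mul_eq_zero_of_mem_mul (hi.sub_one_mem b) ha', neg_zero, sub_eq_zero] at this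
    exact this

end IsSmallAlgebra

section

variable {p : ℕ} {G : Type*} [Group G]

/-- As `[G', G'] ≤ γ₄`, the quotient of `G'` by `γ₂^p γ₄` is elementary abelian. The value `0` taken
by `d` outside `G'` is a placeholder. -/
theorem exists_additive_commutator [Fact p.Prime] (G : Type u) [Group G] :
    ∃ (V : Type u) (_ : AddCommGroup V) (_ : Module (ZMod p) V) (d : G → V),
      (∀ x ∈ commutator G, ∀ y ∈ commutator G, d (x * y) = d x + d y) ∧
      ∀ x ∈ commutator G, d x = 0 ↔ x ∈ gammaTwoPowGammaFour p G := by
  classical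
  obtain ⟨V, _, _, d, hd, hk⟩ := exists_module_hom (p := p) (G := commutator G)
    ((gammaTwoPowGammaFour p G).subgroupOf (commutator G)) (by
      rw [commutator_def (commutator G)]
      refine Subgroup.commutator_le.2 fun x _ y _ => ?_
      exact (le_sup_right : lowerCentral G 4 ≤ gammaTwoPowGammaFour p G)
        (commutator_commutator_le_lowerCentral_four G
          (Subgroup.commutator_mem_commutator x.2 y.2)))
    (fun x => (le_sup_left : powSubgroup (lowerCentral G 2) p ≤ gammaTwoPowGammaFour p G)
        (Subgroup.subset_closure ⟨x.1, by rw [lowerCentral_two]; exact x.2, rfl⟩))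
  refine ⟨V, inferInstance, inferInstance,
    fun x => if hx : x ∈ commutator G then d ⟨x, hx⟩ else 0, fun x hx y hy => ?_, fun x hx => ?_⟩
  · simp only
    rw [dif_pos hx, dif_pos hy, dif_pos (mul_mem hx hy), ← hd]; rfl
  · simp only
    rw [dif_pos hx, hk]; rfl

/-- The map `d` on `G'` extends, via a transversal `t` of `G'`, to a linear map `D` with `D ((x - 1)
* k) = d x`. Independence of `k` kills `K * I`. On `I * I * K` the second difference of `d` under
conjugation is `d ⁅g, ⁅g', x⁆⁆`, which vanishes on `γ₄`. -/
theorem mem_gammaTwoPowGammaFour_of_sub_one_mem [Fact p.Prime] {g : G}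
    (hg : MonoidAlgebra.of (ZMod p) G g - 1 ∈ smallIdeal p G) : g ∈ gammaTwoPowGammaFour p G := by
  obtain ⟨V, _, _, d, hd, hk⟩ := exists_additive_commutator (p := p) G
  have hN : ∀ x ∈ gammaTwoPowGammaFour p G, d x = 0 := fun x hx =>
    (hk x (gammaTwoPowGammaFour_le_commutator p G hx)).2 hx
  let t : G → G := fun g => Quotient.out (Abelianization.of g)
  have ht : ∀ g, g * (t g)⁻¹ ∈ commutator G := by
    intro g
    have : Abelianization.of (t g) = Abelianization.of g := Quotient.out_eq _
    rw [← Abelianization.ker_of, MonoidHom.mem_ker, map_mul, map_inv, this, mul_inv_cancel]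
  let D : MonoidAlgebra (ZMod p) G →ₗ[ZMod p] V := linearExtension fun g => d (g * (t g)⁻¹)
  have hD : ∀ x ∈ commutator G, ∀ k : G,
      D ((MonoidAlgebra.of (ZMod p) G x - 1) * MonoidAlgebra.of _ _ k) = d x := by
    intro x hx k
    have htx : t (x * k) = t k := by
      have : Abelianization.of (x * k) = Abelianization.of k := by
        rw [map_mul, (MonoidHom.mem_ker).1 (by rw [Abelianization.ker_of]; exact hx), one_mul]
      simp only [t, this]
    rw [sub_mul, one_mul, ← map_mul, map_sub, linearExtension_of, linearExtension_of, htx,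
      mul_assoc, hd x hx _ (ht k)]
    abel
  have hconj : ∀ g x k : G, MonoidAlgebra.of (ZMod p) G g *
      ((MonoidAlgebra.of (ZMod p) G x - 1) * MonoidAlgebra.of _ _ k) =
      (MonoidAlgebra.of (ZMod p) G (g * x * g⁻¹) - 1) * MonoidAlgebra.of _ _ (g * k) := by
    intro g x k
    rw [sub_mul, sub_mul, mul_sub, ← map_mul, ← map_mul, ← map_mul, one_mul, one_mul, ← map_mul]
    congr 2
    group
  have hnc : (commutator G).Normal := inferInstance
  have hle : smallIdeal p G ≤ LinearMap.ker D := by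
    rw [smallIdeal, commIdeal_eq_span, augIdeal_eq_span]
    refine sup_le ?_ ?_
    · rw [Submodule.span_mul_span, Submodule.span_le]
      rintro _ ⟨_, ⟨x, hx, k, rfl⟩, _, ⟨g, rfl⟩, rfl⟩
      change D ((MonoidAlgebra.of (ZMod p) G x - 1) * MonoidAlgebra.of _ _ k *
        (MonoidAlgebra.of (ZMod p) G g - 1)) = 0
      rw [mul_sub, mul_one, mul_assoc, ← map_mul, map_sub, hD x hx, hD x hx, sub_self]
    · rw [Submodule.span_mul_span, Submodule.span_mul_span, Submodule.span_le]
      rintro _ ⟨_, ⟨g, rfl⟩, _, ⟨_, ⟨g', rfl⟩, _, ⟨x, hx, k, rfl⟩, rfl⟩, rfl⟩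
      change D ((MonoidAlgebra.of (ZMod p) G g - 1) * ((MonoidAlgebra.of (ZMod p) G g' - 1) *
        ((MonoidAlgebra.of (ZMod p) G x - 1) * MonoidAlgebra.of _ _ k))) = 0
      have c1 : g * x * g⁻¹ ∈ commutator G := hnc.conj_mem x hx g
      have c2 : g' * x * g'⁻¹ ∈ commutator G := hnc.conj_mem x hx g'
      have hu3 : ⁅g', x⁆ ∈ lowerCentral G 3 := by
        rw [lowerCentral_three, Subgroup.commutator_comm]
        exact Subgroup.commutator_mem_commutator trivial hx
      have hu : ⁅g', x⁆ ∈ commutator G := Subgroup.commutator_mem_commutator trivial trivial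
      have hgu : ⁅g, ⁅g', x⁆⁆ ∈ lowerCentral G 4 := by
        rw [lowerCentral_four, Subgroup.commutator_comm]
        exact Subgroup.commutator_mem_commutator trivial hu3
      have e1 : g' * x * g'⁻¹ = ⁅g', x⁆ * x := by simp [commutatorElement_def]
      have e2 : g * (g' * x * g'⁻¹) * g⁻¹ = ⁅g, ⁅g', x⁆⁆ * (⁅g', x⁆ * (g * x * g⁻¹)) := by
        simp only [commutatorElement_def]; group
      have e0 : ∀ y : MonoidAlgebra (ZMod p) G, (MonoidAlgebra.of (ZMod p) G g - 1) *
          ((MonoidAlgebra.of (ZMod p) G g' - 1) * y) =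
          MonoidAlgebra.of (ZMod p) G g * (MonoidAlgebra.of (ZMod p) G g' * y) -
          MonoidAlgebra.of (ZMod p) G g * y - MonoidAlgebra.of (ZMod p) G g' * y + y := by
        intro y; noncomm_ring
      rw [e0, hconj g', hconj g, hconj g, map_add, map_sub, map_sub, hD _ (hnc.conj_mem _ c2 g),
        hD _ c1, hD _ c2, hD _ hx, e2,
        hd _ (lowerCentral_four_le_commutator G hgu) _ (mul_mem hu c1), hd _ hu _ c1, e1,
        hd _ hu _ hx, hN _ ((le_sup_right : lowerCentral G 4 ≤ gammaTwoPowGammaFour p G) hgu)]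
      abel
  have hgc : g ∈ commutator G := by
    have := mem_commIdeal.1 (smallIdeal_le_commIdeal hg)
    rw [map_sub, abelianizationMap_of, map_one, sub_eq_zero] at this
    rw [← Abelianization.ker_of, MonoidHom.mem_ker]
    exact MonoidAlgebra.of_injective (this.trans (map_one _).symm)
  have := hD g hgc 1
  rw [map_one, mul_one] at this
  rw [← hk g hgc, ← this]
  exact hle hg

end

/-! ### Invariance under isomorphisms of group algebras -/

section

variable {p : ℕ} [hp : Fact p.Prime] {G H : Type*} [Group G] [Group H]

/-- No normalisation of `φ` is needed: the augmentation of the image of a `p`-element has some `p ^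
n`-th power `1`, and Frobenius is the identity on `ZMod p`. -/
theorem augmentation_algEquiv (hH : IsPGroup p H)
    (φ : MonoidAlgebra (ZMod p) H →ₐ[ZMod p] MonoidAlgebra (ZMod p) G)
    (x : MonoidAlgebra (ZMod p) H) : augmentation p G (φ x) = augmentation p H x := by
  induction x using MonoidAlgebra.induction_span with
  | hof k =>
    obtain ⟨n, hn⟩ := hH k
    have : (augmentation p G (φ (MonoidAlgebra.of _ _ k))) ^ p ^ n = 1 := by
      rw [← map_pow, ← map_pow, ← map_pow, hn, map_one, map_one, map_one]
    rwa [ZMod.pow_card_pow, ← augmentation_of (p := p) k] at this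
  | hadd x y hx hy => rw [map_add, map_add, map_add, hx, hy]
  | hsmul s x hx => rw [map_smul, map_smul, map_smul, hx]

theorem map_augIdeal_le (hH : IsPGroup p H)
    (φ : MonoidAlgebra (ZMod p) H →ₐ[ZMod p] MonoidAlgebra (ZMod p) G) :
    (augIdeal p H).map φ.toLinearMap ≤ augIdeal p G := by
  rintro _ ⟨x, hx, rfl⟩
  exact (augmentation_algEquiv hH φ x).trans hx

theorem map_commIdeal_le (φ : MonoidAlgebra (ZMod p) H →ₐ[ZMod p] MonoidAlgebra (ZMod p) G) :
    (commIdeal p H).map φ.toLinearMap ≤ commIdeal p G := by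
  rw [commIdeal_eq_span, Submodule.map_span, Submodule.span_le]
  rintro _ ⟨_, ⟨x, hx, k, rfl⟩, rfl⟩
  change φ ((MonoidAlgebra.of (ZMod p) H x - 1) * MonoidAlgebra.of _ _ k) ∈ commIdeal p G
  have h1 : abelianizationMap p G (φ (MonoidAlgebra.of (ZMod p) H x)) = 1 := by
    let ψ : H →* MonoidAlgebra (ZMod p) (Abelianization G) :=
      ((abelianizationMap p G).comp φ : _ →* _).comp (MonoidAlgebra.of (ZMod p) H)
    have hle : commutator H ≤ ψ.ker := by
      rw [commutator_def, Subgroup.commutator_le]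
      intro a _ b _
      rw [MonoidHom.mem_ker, ← sub_eq_zero, map_commutatorElement_sub_one, mul_comm (ψ a), sub_self,
        zero_mul]
    exact hle hx
  rw [mem_commIdeal, map_mul, map_mul, map_sub, map_sub, h1, map_one, map_one, sub_self, zero_mul]

theorem map_eq_of_map_le {R X Y : Type*} [CommSemiring R] [Semiring X] [Semiring Y] [Algebra R X]
    [Algebra R Y] (φ : X ≃ₐ[R] Y) {S : Submodule R X} {T : Submodule R Y}
    (h1 : S.map (φ : X →ₐ[R] Y).toLinearMap ≤ T) (h2 : T.map (φ.symm : Y →ₐ[R] X).toLinearMap ≤ S) :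
    S.map (φ : X →ₐ[R] Y).toLinearMap = T := by
  refine le_antisymm h1 fun y hy => ⟨φ.symm y, h2 ⟨y, hy, rfl⟩, ?_⟩
  exact φ.apply_symm_apply y

theorem map_augIdeal (hG : IsPGroup p G) (hH : IsPGroup p H)
    (φ : MonoidAlgebra (ZMod p) H ≃ₐ[ZMod p] MonoidAlgebra (ZMod p) G) :
    (augIdeal p H).map (φ : MonoidAlgebra (ZMod p) H →ₐ[ZMod p] _).toLinearMap = augIdeal p G :=
  map_eq_of_map_le φ (map_augIdeal_le hH _) (map_augIdeal_le hG _)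

theorem map_commIdeal (φ : MonoidAlgebra (ZMod p) H ≃ₐ[ZMod p] MonoidAlgebra (ZMod p) G) :
    (commIdeal p H).map (φ : MonoidAlgebra (ZMod p) H →ₐ[ZMod p] _).toLinearMap = commIdeal p G :=
  map_eq_of_map_le φ (map_commIdeal_le _) (map_commIdeal_le _)

theorem map_centerAddSq_le (hH : IsPGroup p H)
    (φ : MonoidAlgebra (ZMod p) H ≃ₐ[ZMod p] MonoidAlgebra (ZMod p) G) :
    (centerAddSq p H).map (φ : MonoidAlgebra (ZMod p) H →ₐ[ZMod p] _).toLinearMap ≤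
      centerAddSq p G := by
  rw [centerAddSq, Submodule.map_sup, Submodule.map_mul]
  refine sup_le_sup ?_ (mul_le_mul' (map_augIdeal_le hH _) (map_augIdeal_le hH _))
  rintro _ ⟨x, hx, rfl⟩
  refine (Subalgebra.mem_center_iff (R := ZMod p)).2 fun b => ?_
  obtain ⟨a, rfl⟩ := φ.surjective b
  have := (Subalgebra.mem_center_iff (R := ZMod p)).1 hx a
  exact (map_mul φ a x).symm.trans ((congrArg φ this).trans (map_mul φ x a))

theorem map_centerAddSq (hG : IsPGroup p G) (hH : IsPGroup p H)
    (φ : MonoidAlgebra (ZMod p) H ≃ₐ[ZMod p] MonoidAlgebra (ZMod p) G) :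
    (centerAddSq p H).map (φ : MonoidAlgebra (ZMod p) H →ₐ[ZMod p] _).toLinearMap =
      centerAddSq p G :=
  map_eq_of_map_le φ (map_centerAddSq_le hH _) (map_centerAddSq_le hG _)

/-- The index of the product of the Frattini subgroup and the center is determined by the group
algebra. -/
theorem card_quotient_eq [Finite G] [Finite H] (hG : IsPGroup p G) (hH : IsPGroup p H)
    (φ : MonoidAlgebra (ZMod p) H ≃ₐ[ZMod p] MonoidAlgebra (ZMod p) G) :
    Nat.card (H ⧸ (frattini H ⊔ Subgroup.center H)) =
      Nat.card (G ⧸ (frattini G ⊔ Subgroup.center G)) := by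
  rw [← card_quotient_centerAddSq hG, ← card_quotient_centerAddSq hH]
  exact Nat.card_congr (Submodule.Quotient.equiv _ _ φ.toLinearEquiv
    (map_centerAddSq hG hH φ)).toEquiv

variable {A : Type*} [Ring A] [Algebra (ZMod p) A] {π : MonoidAlgebra (ZMod p) G →ₐ[ZMod p] A}

/-- For the commutator condition: modulo `K * I` a generator `(x - 1) * g` equals `x - 1`, and
products in `G'` become sums because `K * K ≤ K * I`. -/
theorem isBasisHom_of_smallIdeal (hπ : ∀ x ∈ smallIdeal p G, π x = 0) :
    IsBasisHom ((augIdeal p G).map π.toLinearMap) ((commIdeal p G).map π.toLinearMap)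
      ((π : MonoidAlgebra (ZMod p) G →* A).comp (MonoidAlgebra.of (ZMod p) G)) where
  sub_one_mem g := ⟨_, of_sub_one_mem_augIdeal g, by
    change π (MonoidAlgebra.of (ZMod p) G g - 1) = π (MonoidAlgebra.of (ZMod p) G g) - 1
    rw [map_sub, map_one]⟩
  exists_sub_mem_sq := by
    rintro _ ⟨x, hx, rfl⟩
    obtain ⟨g, hg⟩ := exists_sub_mem_augIdeal_sq hx
    refine ⟨g, ?_⟩
    rw [← Submodule.map_mul]
    refine ⟨_, hg, ?_⟩
    change π (x - (MonoidAlgebra.of (ZMod p) G g - 1)) =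
      π x - (π (MonoidAlgebra.of (ZMod p) G g) - 1)
    rw [map_sub, map_sub, map_one]
  exists_commutator := by
    rintro _ ⟨m, hm, rfl⟩
    change ∃ x ∈ commutator G, π (MonoidAlgebra.of (ZMod p) G x) = 1 + π m
    have hadd : ∀ m ∈ commIdeal p G, ∀ m' ∈ commIdeal p G,
        (∃ x ∈ commutator G, π (MonoidAlgebra.of (ZMod p) G x) = 1 + π m) →
        (∃ x ∈ commutator G, π (MonoidAlgebra.of (ZMod p) G x) = 1 + π m') →
        ∃ x ∈ commutator G, π (MonoidAlgebra.of (ZMod p) G x) = 1 + π (m + m') := by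
      rintro m hm m' hm' ⟨x, hx, hxm⟩ ⟨y, hy, hym⟩
      refine ⟨x * y, mul_mem hx hy, ?_⟩
      have h0 : π m * π m' = 0 := by
        rw [← map_mul]
        exact hπ _ (Submodule.mem_sup_left (Submodule.mul_mem_mul hm (commIdeal_le_augIdeal hm')))
      rw [map_mul, map_mul, hxm, hym, map_add, mul_add, add_mul, add_mul, h0]
      noncomm_ring
    have hspan := hm
    rw [commIdeal_eq_span] at hspan
    clear hm
    induction hspan using Submodule.span_induction with
    | mem y hy =>
      obtain ⟨x, hx, g, rfl⟩ := hy
      refine ⟨x, hx, ?_⟩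
      have h1 : MonoidAlgebra.of (ZMod p) G x - 1 ∈ commIdeal p G := by
        rw [commIdeal_eq_span]
        exact Submodule.subset_span ⟨x, hx, 1, by rw [map_one, mul_one]⟩
      have h0 := hπ _ (Submodule.mem_sup_left
        (Submodule.mul_mem_mul h1 (of_sub_one_mem_augIdeal g)))
      rw [mul_sub, mul_one, map_sub, sub_eq_zero] at h0
      rw [h0, map_sub, map_one]
      abel
    | zero => exact ⟨1, one_mem _, by rw [map_one, map_one, map_zero, add_zero]⟩
    | add x y hx hy hx' hy' =>
      rw [← commIdeal_eq_span] at hx hy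
      exact hadd x hx y hy hx' hy'
    | smul s x hx hx' =>
      rw [← commIdeal_eq_span] at hx
      obtain ⟨k, rfl⟩ := ZMod.natCast_zmod_surjective s
      rw [Nat.cast_smul_eq_nsmul]
      induction k with
      | zero => exact ⟨1, one_mem _, by simp [-MonoidAlgebra.of_apply]⟩
      | succ k ih => rw [succ_nsmul]; exact hadd _ (nsmul_mem hx k) _ hx ih hx'

theorem isSmallAlgebra_of_smallIdeal (hs : Function.Surjective π)
    (hπ : ∀ x ∈ smallIdeal p G, π x = 0) :
    IsSmallAlgebra ((augIdeal p G).map π.toLinearMap) ((commIdeal p G).map π.toLinearMap) where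
  mul_mem_left := by
    rintro a _ ⟨x, hx, rfl⟩
    obtain ⟨b, rfl⟩ := hs a
    exact ⟨b * x, mul_mem_augIdeal_left b hx, map_mul π b x⟩
  mul_mem_right := by
    rintro a _ ⟨x, hx, rfl⟩
    obtain ⟨b, rfl⟩ := hs a
    exact ⟨x * b, mul_mem_augIdeal_right b hx, map_mul π x b⟩
  mul_mem_left' := by
    rintro a _ ⟨x, hx, rfl⟩
    obtain ⟨b, rfl⟩ := hs a
    exact ⟨b * x, mul_mem_commIdeal_left b hx, map_mul π b x⟩
  comm := by
    intro a b
    obtain ⟨a, rfl⟩ := hs a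
    obtain ⟨b, rfl⟩ := hs b
    refine ⟨a * b - b * a, bracket_mem_commIdeal a b, ?_⟩
    change π (a * b - b * a) = _
    rw [map_sub, map_mul, map_mul]
  le_sq := by
    rw [← Submodule.map_mul]
    exact Submodule.map_mono commIdeal_le_sq
  mul_eq_zero := by
    rintro _ ⟨m, hm, rfl⟩ _ ⟨x, hx, rfl⟩
    exact (map_mul π m x).symm.trans
      (hπ _ (Submodule.mem_sup_left (Submodule.mul_mem_mul hm hx)))
  mul_mul_eq_zero := by
    rintro _ ⟨x, hx, rfl⟩ _ ⟨y, hy, rfl⟩ _ ⟨m, hm, rfl⟩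
    change π x * (π y * π m) = 0
    rw [← map_mul, ← map_mul]
    exact hπ _ (Submodule.mem_sup_right (Submodule.mul_mem_mul hx (Submodule.mul_mem_mul hy hm)))
  exists_sub_mem := by
    intro a
    obtain ⟨b, rfl⟩ := hs a
    refine ⟨augmentation p G b, b - augmentation p G b • 1, by
      rw [SetLike.mem_coe, mem_augIdeal, map_sub, map_smul, map_one, smul_eq_mul, mul_one,
        sub_self], ?_⟩
    change π (b - augmentation p G b • 1) = _
    rw [map_sub, map_smul, map_one]

variable (p) in
/-- The group algebra has a quotient algebra by `smallIdeal`. -/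
theorem exists_quotient_smallIdeal (G : Type u) [Group G] : ∃ (A : Type u) (_ : Ring A) (_ : Algebra (ZMod p) A)
    (π : MonoidAlgebra (ZMod p) G →ₐ[ZMod p] A), Function.Surjective π ∧
      ∀ x, π x = 0 ↔ x ∈ smallIdeal p G := by
  let J : Ideal (MonoidAlgebra (ZMod p) G) :=
    { carrier := smallIdeal p G
      add_mem' := fun hx hy => add_mem hx hy
      zero_mem' := zero_mem _
      smul_mem' := fun a _ hx => mul_mem_smallIdeal_left a hx }
  have : J.IsTwoSided := ⟨fun b hx => mul_mem_smallIdeal_right b hx⟩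
  exact ⟨MonoidAlgebra (ZMod p) G ⧸ J, inferInstance, inferInstance, Ideal.Quotient.mkₐ _ J,
    Ideal.Quotient.mkₐ_surjective _ J, fun x => Ideal.Quotient.eq_zero_iff_mem⟩

end

/-! ### The surjection between the quotients and the conclusion -/

section

variable {p : ℕ} [hp : Fact p.Prime]

/-- A subgroup that meets every coset modulo the square of the augmentation ideal is everything. -/
theorem eq_top_of_forall_exists_sub_mem_sq {G : Type*} [Group G] [Finite G] (hG : IsPGroup p G)
    {S : Subgroup G} (hS : ∀ g, ∃ k ∈ S, MonoidAlgebra.of (ZMod p) G g - MonoidAlgebra.of _ _ k ∈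
      augIdeal p G * augIdeal p G) : S = ⊤ := by
  by_contra hne
  obtain ⟨χ, hχ, g, hg⟩ := exists_char_of_ne_top hG hne
  obtain ⟨k, hk, hgk⟩ := hS g
  have := linearExtension_eq_zero_of_mem_sq (v := fun g => (χ g).toAdd)
    (fun x y => by rw [map_mul, toAdd_mul]) hgk
  rw [map_sub, linearExtension_of, linearExtension_of, (MonoidHom.mem_ker).1 (hχ hk), toAdd_one,
    sub_zero, toAdd_eq_zero] at this
  exact hg this

/-- The straightened map `f` has values in `i(G)`, which is `G` modulo `γ₂^p γ₄`; it is onto because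
it agrees with `j` modulo `I * I`, and `j(H)` meets every such class of `i(G)`. -/
theorem exists_surjective_quotient {G H : Type*} [Group G] [Group H] [Finite G] [Finite H]
    (hp3 : 3 ≤ p) (hG : IsPGroup p G) (hH : IsPGroup p H)
    (φ : MonoidAlgebra (ZMod p) H ≃ₐ[ZMod p] MonoidAlgebra (ZMod p) G)
    (hcard : Nat.card (H ⧸ (frattini H ⊔ Subgroup.center H)) = p ^ 2) :
    ∃ F : H ⧸ gammaTwoPowGammaFour p H →* G ⧸ gammaTwoPowGammaFour p G, Function.Surjective F := by
  obtain ⟨A, _, _, π, hs, hπ⟩ := exists_quotient_smallIdeal p G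
  have hπ0 : ∀ x ∈ smallIdeal p G, π x = 0 := fun x => (hπ x).2
  let φ' : MonoidAlgebra (ZMod p) H →ₐ[ZMod p] MonoidAlgebra (ZMod p) G := φ
  have hφI : (augIdeal p H).map φ'.toLinearMap = augIdeal p G := map_augIdeal hG hH φ
  have hφK : (commIdeal p H).map φ'.toLinearMap = commIdeal p G := map_commIdeal φ
  have hφJ : (smallIdeal p H).map φ'.toLinearMap = smallIdeal p G := by
    rw [smallIdeal, Submodule.map_sup, Submodule.map_mul, Submodule.map_mul, Submodule.map_mul,
      hφI, hφK, smallIdeal]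
  set I := (augIdeal p G).map π.toLinearMap with hI
  set M := (commIdeal p G).map π.toLinearMap with hM
  have h : IsSmallAlgebra I M := isSmallAlgebra_of_smallIdeal hs hπ0
  let i : G →* A := (π : MonoidAlgebra (ZMod p) G →* A).comp (MonoidAlgebra.of (ZMod p) G)
  have hi : IsBasisHom I M i := isBasisHom_of_smallIdeal hπ0
  let π' : MonoidAlgebra (ZMod p) H →ₐ[ZMod p] A := π.comp φ'
  have hs' : Function.Surjective π' := hs.comp φ.surjective
  let j : H →* A := (π' : MonoidAlgebra (ZMod p) H →* A).comp (MonoidAlgebra.of (ZMod p) H)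
  have hj : IsBasisHom I M j := by
    have h1 : I = (augIdeal p H).map π'.toLinearMap := by
      rw [hI, ← hφI, ← Submodule.map_comp]; rfl
    have h2 : M = (commIdeal p H).map π'.toLinearMap := by
      rw [hM, ← hφK, ← Submodule.map_comp]; rfl
    rw [h1, h2]
    refine isBasisHom_of_smallIdeal fun x hx => hπ0 _ ?_
    rw [← hφJ]
    exact ⟨x, hx, rfl⟩
  have hsq : ∀ x, π x ∈ I * I → x ∈ augIdeal p G * augIdeal p G := by
    intro x hx
    rw [hI, ← Submodule.map_mul] at hx
    obtain ⟨y, hy, hyx⟩ := hx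
    have : π (x - y) = 0 := by rw [map_sub, sub_eq_zero]; exact hyx.symm
    simpa using add_mem (smallIdeal_le_sq ((hπ _).1 this)) hy
  have hMK : ∀ x, π x ∈ M → x ∈ commIdeal p G := by
    rintro x ⟨y, hy, hyx⟩
    have : π (x - y) = 0 := by rw [map_sub, sub_eq_zero]; exact hyx.symm
    simpa using add_mem (smallIdeal_le_commIdeal ((hπ _).1 this)) hy
  -- The small ideal lies in the augmentation ideal, so it contains no nonzero scalar.
  have hchar : CharP A p := by
    refine charP_of_injective_algebraMap ((injective_iff_map_eq_zero (algebraMap (ZMod p) A)).2 fun s hs0 => ?_) p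
    have h1 : π (s • 1) = 0 := by rw [map_smul, map_one, ← Algebra.algebraMap_eq_smul_one, hs0]
    have h2 := mem_augIdeal.1 (commIdeal_le_augIdeal (smallIdeal_le_commIdeal ((hπ _).1 h1)))
    simpa using h2
  have hcenG : ∀ z ∈ Subgroup.center G, ∀ a : A, i z * a = a * i z := by
    intro z hz a
    obtain ⟨b, rfl⟩ := hs a
    exact (map_mul π _ b).symm.trans ((congrArg π (of_mem_center hz b)).trans (map_mul π b _))
  have hcenH : ∀ z ∈ Subgroup.center H, ∀ a : A, j z * a = a * j z := by
    intro z hz a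
    obtain ⟨b, rfl⟩ := hs' a
    exact (map_mul π' _ b).symm.trans ((congrArg π' (of_mem_center hz b)).trans (map_mul π' b _))
  have hroot : ∀ (e : ℕ) (a : A), (a - 1) ^ p ^ e ∈ M → a - 1 ∈ Submodule.span (ZMod p)
      {y | ∃ q ∈ rootsOfCommutator G (p ^ e), ∃ b : A, (i q - 1) * b = y} := by
    intro e a ha
    obtain ⟨x, rfl⟩ := hs a
    have e1 : π x - 1 = π (x - 1) := by rw [map_sub, map_one]
    rw [e1, ← map_pow] at ha
    rw [e1]
    have h1 := Submodule.mem_map_of_mem (f := π.toLinearMap)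
      (mem_span_of_pow_mem_commIdeal e (hMK _ ha))
    rw [Submodule.map_span] at h1
    refine Submodule.span_mono ?_ h1
    rintro _ ⟨_, ⟨q, hq, b, rfl⟩, rfl⟩
    refine ⟨q, hq, π b, ?_⟩
    change (π (MonoidAlgebra.of (ZMod p) G q) - 1) * π b =
      π ((MonoidAlgebra.of (ZMod p) G q - 1) * b)
    rw [map_mul, map_sub, map_one]
  have hZ : ∀ (g : G) (k : H), k ∈ frattini H ⊔ Subgroup.center H → j k - i g ∈ I * I →
      g ∈ frattini G ⊔ Subgroup.center G := by
    intro g k hk hkg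
    rw [← ker_toQuotient hG, mem_ker_toQuotient]
    rw [← ker_toQuotient hH, mem_ker_toQuotient] at hk
    have h1 : φ' (MonoidAlgebra.of (ZMod p) H k) ∈ centerAddSq p G :=
      map_centerAddSq_le hH φ ⟨_, hk, rfl⟩
    have h2 := hsq (φ' (MonoidAlgebra.of (ZMod p) H k) - MonoidAlgebra.of (ZMod p) G g)
      (by rw [map_sub]; exact hkg)
    simpa using sub_mem h1 (Submodule.mem_sup_right h2 : _ ∈ centerAddSq p G)
  obtain ⟨a, b, h₁, h₂, ha, hb, ha₁, ha₂, hb₁, hb₂, hab⟩ := exists_coordinates hH hcard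
  obtain ⟨f, hfc, hfj, hfi⟩ := h.exists_hom hi hj hp3 hH hcenG hcenH hroot hZ ha hb ha₁ ha₂ hb₁ hb₂
    hab
  have hinj : ∀ g g', i g = i g' →
      (g : G ⧸ gammaTwoPowGammaFour p G) = (g' : G ⧸ gammaTwoPowGammaFour p G) := by
    intro g g' hgg
    rw [QuotientGroup.eq]
    refine mem_gammaTwoPowGammaFour_of_sub_one_mem ((hπ _).1 ?_)
    have e : i (g⁻¹ * g') = 1 := by rw [map_mul, ← hgg, ← map_mul, inv_mul_cancel, map_one]
    rw [map_sub, map_one, sub_eq_zero]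
    exact e
  choose t ht using hfi
  let F₀ : H →* G ⧸ gammaTwoPowGammaFour p G :=
    MonoidHom.mk' (fun k => (t k : G ⧸ gammaTwoPowGammaFour p G)) fun x y => by
      rw [← QuotientGroup.mk_mul]
      refine hinj _ _ ?_
      rw [map_mul, ← ht, ← ht, ← ht, map_mul]
  have hF₀ : ∀ k g, f k = i g → F₀ k = g := fun k g hkg => hinj _ _ (by rw [← ht, hkg])
  -- This subgroup lies in `H'`, where `f` coincides with `j`, and `j` is trivial on it.
  have hker : gammaTwoPowGammaFour p H ≤ F₀.ker := by
    intro k hk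
    rw [MonoidHom.mem_ker]
    refine hF₀ k 1 ?_
    rw [hfc k (gammaTwoPowGammaFour_le_commutator p H hk), h.map_eq_one hj hk, map_one]
  have hsurj : F₀.range.comap (QuotientGroup.mk' (gammaTwoPowGammaFour p G)) = ⊤ := by
    refine eq_top_of_forall_exists_sub_mem_sq hG fun g => ?_
    obtain ⟨k, hk⟩ := hj.exists_sub_mem_sq _ (hi.sub_one_mem g)
    refine ⟨t k, ⟨k, rfl⟩, hsq _ ?_⟩
    have e : π (MonoidAlgebra.of (ZMod p) G g - MonoidAlgebra.of (ZMod p) G (t k)) =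
        (i g - 1 - (j k - 1)) - (f k - j k) := by
      rw [map_sub, ht]
      change i g - i (t k) = _
      abel
    rw [e]
    exact sub_mem hk (hfj k)
  refine ⟨QuotientGroup.lift _ F₀ hker, fun y => ?_⟩
  obtain ⟨g, rfl⟩ := QuotientGroup.mk_surjective y
  have : g ∈ F₀.range.comap (QuotientGroup.mk' (gammaTwoPowGammaFour p G)) := by
    rw [hsurj]; trivial
  obtain ⟨k, hk⟩ := this
  exact ⟨k, hk⟩

end

theorem mainTheorem3 (p : ℕ) (hp : p.Prime) (hodd : Odd p)
    (G H : Type*) [Group G] [Group H] [Finite G] [Finite H]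
    (hG : IsPGroup p G) (hH : IsPGroup p H)
    (hFGH : Nonempty (MonoidAlgebra (ZMod p) G ≃ₐ[ZMod p] MonoidAlgebra (ZMod p) H))
    (hcard : Nat.card (G ⧸ (frattini G ⊔ Subgroup.center G)) = p ^ 2) :
    Nonempty ((G ⧸ gammaTwoPowGammaFour p G) ≃* (H ⧸ gammaTwoPowGammaFour p H)) := by
  have : Fact p.Prime := ⟨hp⟩
  have hp3 : 3 ≤ p := by
    obtain ⟨k, hk⟩ := hodd
    have := hp.two_le
    omega
  obtain ⟨φ⟩ := hFGH
  have hcard' : Nat.card (H ⧸ (frattini H ⊔ Subgroup.center H)) = p ^ 2 := by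
    rw [card_quotient_eq hG hH φ.symm, hcard]
  -- The hypotheses are now symmetric in `G` and `H`; surjections both ways force equal finite
  -- orders.
  obtain ⟨F, hF⟩ := exists_surjective_quotient hp3 hH hG φ hcard
  obtain ⟨F', hF'⟩ := exists_surjective_quotient hp3 hG hH φ.symm hcard'
  have hle := Nat.card_le_card_of_surjective F' hF'
  have hbij : Function.Bijective F := (Nat.bijective_iff_surjective_and_card F).2
    ⟨hF, le_antisymm hle (Nat.card_le_card_of_surjective F hF)⟩
  exact ⟨MulEquiv.ofBijective F hbij⟩
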